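/- For a number field $E$ and an integer $m\ge 1$ let $a_m(E)$ be the number of ideals of norm $m$ in the ring of integers of $E$, and let $\widetilde E$ be the Galois closure of $E$ over $\mathbb{Q}$ in a fixed algebraic closure of $\mathbb{Q}$. For number fields $K$ and $L$ let $T_{K,L}$ be the set of rational primes $p$ that are unramified in both $K$ and $L$ and satisfy $a_p(K)=a_p(L)$, and put \[\delta_{K,L} := \frac{2}{[\widetilde K\widetilde L:\mathbb{Q}]}+1-\frac{1}{[\widetilde K:\mathbb{Q}]}-\frac{1}{[\widetilde L:\mathbb{Q}]}.\] Let $K$ and $L$ be number fields of the same degree $n$ over $\mathbb{Q}$. Then $T_{K,L}$ has a Dirichlet density \[\delta(T_{K,L}) = \lim_{s\to 1^+}\frac{\sum_{p\in T_{K,L}}p^{-s}}{\sum_{p}p^{-s}},\] where the sum in the denominator is over all rational primes, and \[\delta(T_{K,L})\le \delta_{K,L}.\] If both $K$ and $L$ are Galois over $\mathbb{Q}$, then $\delta(T_{K,L})=\delta_{K,L}$. -/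

import Mathlib

namespace ArithEquiv

noncomputable section

open NumberField

/-- A set `S` of rational primes has Dirichlet density `d`: the ratio of `∑_{p ∈ S} p ^ (-s)` to
`∑_p p ^ (-s)` tends to `d` as `s → 1⁺`. This is Mathlib's notion for the number field `ℚ`, carried
over along the bijection between the nonzero primes of the ring of integers of `ℚ` and the rational
primes. -/
def HasDensity (S : Set Nat.Primes) (d : ℝ) : Prop :=
  NumberField.Set.HasDirichletDensity
    ((Rat.HeightOneSpectrum.primesEquiv : IsDedekindDomain.HeightOneSpectrum (𝓞 ℚ) ≃ Nat.Primes)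
      ⁻¹' S) d

/-- The `m`-th coefficient `a_m(E)` of the Dedekind zeta function of `E`: the number of ideals of
the ring of integers of norm `m`. -/
def zetaCoeff (E : Type*) [Field E] [NumberField E] (m : ℕ) : ℕ :=
  Nat.card {I : Ideal (𝓞 E) // Ideal.absNorm I = m}

/-- The rational prime `p` is unramified in the number field `E`. -/
def Unramified (E : Type*) [Field E] [NumberField E] (p : Nat.Primes) : Prop :=
  Algebra.IsUnramifiedIn (𝓞 E) (Ideal.span {((p : ℕ) : ℤ)})

/-- The set of primes that ramify in `K` or in `L`. -/
def Ram (K L : Type*) [Field K] [NumberField K] [Field L] [NumberField L] : Set Nat.Primes :=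
  {p | ¬ Unramified K p ∨ ¬ Unramified L p}

/-- `T_{K,L}`: the primes `p` with `a_p(K) = a_p(L)`, those ramified in `K` or `L` removed. -/
def T (K L : Type*) [Field K] [NumberField K] [Field L] [NumberField L] : Set Nat.Primes :=
  {p | zetaCoeff K p = zetaCoeff L p} \ Ram K L

/-- The Galois closure of `E` over `ℚ`, inside a fixed algebraic closure of `ℚ`: the compositum of
the images of all embeddings of `E`. -/
abbrev galoisClosure (E : Type*) [Field E] [NumberField E] :
    IntermediateField ℚ (AlgebraicClosure ℚ) :=
  IntermediateField.normalClosure ℚ E (AlgebraicClosure ℚ)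

/-- `δ_{K,L} = 2 / [K̃L̃ : ℚ] + 1 - 1 / [K̃ : ℚ] - 1 / [L̃ : ℚ]`. -/
def delta (K L : Type*) [Field K] [NumberField K] [Field L] [NumberField L] : ℝ :=
  2 / (Module.finrank ℚ ↥(galoisClosure K ⊔ galoisClosure L) : ℝ) + 1
    - 1 / (Module.finrank ℚ ↥(galoisClosure K) : ℝ)
    - 1 / (Module.finrank ℚ ↥(galoisClosure L) : ℝ)

end

end ArithEquiv

namespace ArithEquiv

noncomputable section

open NumberField

/-! ### Ideal counts: multiplicativity and growth at prime powers. -/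

section ZetaCoeff

variable (E : Type*) [Field E] [NumberField E]

/-! Let `M` be the compositum of the two Galois closures, `G` its Galois group, and `H₁`, `H₂` the
subgroups fixing `K` and `L`. For `p` unramified in `M`, `a_p(K)` is the number of fixed points of
Frobenius on `G ⧸ H₁` (`zetaCoeff_eq_permChar`). Hence, up to finitely many primes, `T K L` is the
set of `p` at whose Frobenius the two permutation characters agree.

The density exists by Frobenius' theorem, so Chebotarev is not needed. The simple pole of the zeta
function of the fixed field of `H` gives `permChar H` mean value 1 (`hasMean_permChar`), and
permutation characters span all functions that depend only on the conjugacy class of the generated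
cyclic subgroup (`ConstOnDivisions.mem_of_permChar_mem`).

For the bound, let `Nᵢ` be the normal core of `Hᵢ`; then `N₁ ⊓ N₂ = ⊥`. A permutation character
reaches its maximum `n` exactly on the core, so where the two agree, `g` lies in both cores or in
neither. The indicator of agreement is therefore at most `1 - 1_{N₁} - 1_{N₂} + 2 · 1_{1}`, whose
mean value is `delta K L`. In the Galois case the characters are `n · 1_{Nᵢ}` and this inequality is
an equality. -/

instance finite_ideal_absNorm (m : ℕ) : Finite {I : Ideal (𝓞 E) // Ideal.absNorm I = m} :=
  Set.Finite.to_subtype (Ideal.finite_setOfPred_absNorm_eq m)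

theorem zetaCoeff_one : zetaCoeff E 1 = 1 := by
  rw [zetaCoeff, Nat.card_eq_one_iff_exists]
  exact ⟨⟨⊤, Ideal.absNorm_top⟩, fun ⟨I, hI⟩ ↦ Subtype.ext (Ideal.absNorm_eq_one_iff.mp hI)⟩

variable {E}

theorem natCast_mem_of_absNorm_dvd {I : Ideal (𝓞 E)} {m : ℕ} (h : Ideal.absNorm I ∣ m) :
    (m : 𝓞 E) ∈ I := by
  obtain ⟨k, rfl⟩ := h
  push_cast
  exact I.mul_mem_right _ (Ideal.absNorm_mem I)

theorem sup_span_mul_sup_span_of_coprime {I : Ideal (𝓞 E)} {m n : ℕ} (h : m.Coprime n)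
    (hI : Ideal.absNorm I = m * n) :
    (I ⊔ Ideal.span {(m : 𝓞 E)}) * (I ⊔ Ideal.span {(n : 𝓞 E)}) = I := by
  have hmn : (m * n : 𝓞 E) ∈ I := by
    have := natCast_mem_of_absNorm_dvd hI.dvd
    push_cast at this
    exact this
  apply le_antisymm
  · rw [Ideal.sup_mul, Ideal.mul_sup, Ideal.mul_sup, Ideal.span_singleton_mul_span_singleton]
    refine sup_le (sup_le Ideal.mul_le_right Ideal.mul_le_left)
      (sup_le Ideal.mul_le_right ?_)
    rwa [Ideal.span_singleton_le_iff_mem]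
  · intro x hx
    have hc : IsCoprime (m : 𝓞 E) (n : 𝓞 E) := by
      simpa using (Nat.isCoprime_iff_coprime.mpr h).map (Int.castRingHom (𝓞 E))
    obtain ⟨u, v, huv⟩ := hc
    have hx' : x = u * (m * x) + v * (x * n) := by
      linear_combination (-x) * huv
    rw [hx']
    refine add_mem (Ideal.mul_mem_left _ _ (Ideal.mul_mem_mul ?_ ?_))
      (Ideal.mul_mem_left _ _ (Ideal.mul_mem_mul ?_ ?_))
    · exact (le_sup_right : _ ≤ I ⊔ _) (Ideal.mem_span_singleton_self _)
    · exact (le_sup_left : I ≤ _) hx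
    · exact (le_sup_left : I ≤ _) hx
    · exact (le_sup_right : _ ≤ I ⊔ _) (Ideal.mem_span_singleton_self _)

/-- The norm divides both `m * n` and the norm `m ^ d` of `(m)`, hence `m`. The same holds for `n`,
and the product of the two ideals is `I`, so both divisibilities are equalities. -/
theorem absNorm_sup_span_of_coprime {I : Ideal (𝓞 E)} {m n : ℕ} (h : m.Coprime n)
    (hn : n ≠ 0) (hI : Ideal.absNorm I = m * n) :
    Ideal.absNorm (I ⊔ Ideal.span {(m : 𝓞 E)}) = m := by
  have key : ∀ {a b : ℕ}, a.Coprime b → Ideal.absNorm I = a * b →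
      Ideal.absNorm (I ⊔ Ideal.span {(a : 𝓞 E)}) ∣ a := by
    intro a b hab hI
    have h1 : Ideal.absNorm (I ⊔ Ideal.span {(a : 𝓞 E)}) ∣ a * b :=
      hI ▸ Ideal.absNorm_dvd_absNorm_of_le le_sup_left
    have h2 : Ideal.absNorm (I ⊔ Ideal.span {(a : 𝓞 E)}) ∣ a ^ Module.finrank ℤ (𝓞 E) := by
      have := Ideal.absNorm_dvd_absNorm_of_le (le_sup_right : Ideal.span {(a : 𝓞 E)} ≤ I ⊔ _)
      rw [Ideal.absNorm_span_singleton] at this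
      have h3 : (a : 𝓞 E) = algebraMap ℤ (𝓞 E) a := by simp
      rwa [h3, Algebra.norm_algebraMap, ← h3, Int.natAbs_pow, Int.natAbs_natCast] at this
    exact (Nat.Coprime.coprime_dvd_left h2 (hab.pow_left _)).dvd_of_dvd_mul_right h1
  have h1 := key h hI
  have h2 := key h.symm (hI.trans (mul_comm _ _))
  have h3 := congrArg Ideal.absNorm (sup_span_mul_sup_span_of_coprime h hI)
  rw [map_mul, hI] at h3
  refine Nat.dvd_antisymm h1 ?_
  have h4 : m * n ∣ Ideal.absNorm (I ⊔ Ideal.span {(m : 𝓞 E)}) * n :=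
    h3 ▸ Nat.mul_dvd_mul_left _ h2
  exact Nat.dvd_of_mul_dvd_mul_right (Nat.pos_of_ne_zero hn) h4

theorem eq_of_le_of_absNorm_eq {I J : Ideal (𝓞 E)} (h : I ≤ J) (hI : Ideal.absNorm I ≠ 0)
    (hIJ : Ideal.absNorm I = Ideal.absNorm J) : I = J := by
  obtain ⟨A, rfl⟩ := Ideal.dvd_iff_le.mpr h
  rw [map_mul] at hIJ hI
  have : Ideal.absNorm A = 1 := by
    rcases mul_eq_left₀ (left_ne_zero_of_mul hI) |>.mp hIJ with h
    exact h
  rw [Ideal.absNorm_eq_one_iff.mp this, Ideal.mul_top]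

theorem sup_span_eq_of_coprime {I J : Ideal (𝓞 E)} {m n : ℕ} (h : m.Coprime n)
    (hm : m ≠ 0) (hn : n ≠ 0) (hI : Ideal.absNorm I = m) (hJ : Ideal.absNorm J = n) :
    I * J ⊔ Ideal.span {(m : 𝓞 E)} = I := by
  have h1 : Ideal.absNorm (I * J ⊔ Ideal.span {(m : 𝓞 E)}) = m :=
    absNorm_sup_span_of_coprime h hn (by rw [map_mul, hI, hJ])
  refine eq_of_le_of_absNorm_eq (sup_le Ideal.mul_le_left ?_) (h1.trans_ne hm) (h1.trans hI.symm)
  rw [Ideal.span_singleton_le_iff_mem]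
  exact natCast_mem_of_absNorm_dvd hI.dvd

variable (E) in
theorem zetaCoeff_mul_of_coprime {m n : ℕ} (h : m.Coprime n) (hm : m ≠ 0) (hn : n ≠ 0) :
    zetaCoeff E (m * n) = zetaCoeff E m * zetaCoeff E n := by
  rw [zetaCoeff, zetaCoeff, zetaCoeff, ← Nat.card_prod]
  refine Nat.card_congr
    { toFun := fun I ↦ ⟨⟨I.1 ⊔ Ideal.span {(m : 𝓞 E)}, absNorm_sup_span_of_coprime h hn I.2⟩,
        ⟨I.1 ⊔ Ideal.span {(n : 𝓞 E)},
          absNorm_sup_span_of_coprime h.symm hm (I.2.trans (mul_comm _ _))⟩⟩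
      invFun := fun P ↦ ⟨P.1.1 * P.2.1, by rw [map_mul, P.1.2, P.2.2]⟩
      left_inv := fun I ↦ Subtype.ext (sup_span_mul_sup_span_of_coprime h I.2)
      right_inv := ?_ }
  rintro ⟨⟨I, hI⟩, ⟨J, hJ⟩⟩
  refine Prod.ext (Subtype.ext (sup_span_eq_of_coprime h hm hn hI hJ)) (Subtype.ext ?_)
  simpa only [mul_comm I J] using sup_span_eq_of_coprime h.symm hn hm hJ hI

variable (E) in
-- Such an ideal is determined by its exponents, each at most `e`, at the primes above `p`, of which
-- there are at most `[E : ℚ]`.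
theorem zetaCoeff_prime_pow_le {p : ℕ} (hp : p.Prime) (e : ℕ) :
    zetaCoeff E (p ^ e) ≤ (e + 1) ^ Module.finrank ℤ (𝓞 E) := by
  classical
  let 𝔭 : Ideal ℤ := Ideal.span {(p : ℤ)}
  have h𝔭 : 𝔭 ≠ ⊥ := by simp [𝔭, hp.ne_zero]
  have : 𝔭.IsPrime := (Ideal.span_singleton_prime (by simp [hp.ne_zero])).mpr
    (Nat.prime_iff_prime_int.mp hp)
  have : 𝔭.IsMaximal := this.isMaximal h𝔭
  have hfin : Finite (𝔭.primesOver (𝓞 E)) := IsDedekindDomain.primesOver_finite 𝔭 (𝓞 E)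
  have := Fintype.ofFinite (𝔭.primesOver (𝓞 E))
  have hcard : Nat.card (𝔭.primesOver (𝓞 E)) ≤ Module.finrank ℤ (𝓞 E) := by
    rw [← Ideal.sum_ramification_inertia_eq_finrank 𝔭, Nat.card_eq_fintype_card, ← Finset.card_univ,
      Finset.card_eq_sum_ones]
    refine Finset.sum_le_sum fun P _ ↦ ?_
    have := P.2.1
    exact Nat.mul_pos (Ideal.ramificationIdx_pos _ _)
      (Ideal.inertiaDeg_pos _ _)
  have hne : ∀ I : {I : Ideal (𝓞 E) // Ideal.absNorm I = p ^ e}, I.1 ≠ ⊥ := fun I h ↦ by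
    have := I.2
    rw [h, Ideal.absNorm_bot] at this
    exact pow_ne_zero _ hp.ne_zero this.symm
  let c (I : {I : Ideal (𝓞 E) // Ideal.absNorm I = p ^ e}) (P : 𝔭.primesOver (𝓞 E)) :
      Fin (e + 1) := ⟨(UniqueFactorizationMonoid.normalizedFactors I.1).count P.1, by
    set k := (UniqueFactorizationMonoid.normalizedFactors I.1).count P.1 with hk
    rw [Nat.lt_succ_iff]
    have h1 : P.1 ^ k ∣ I.1 := by
      rw [← Ideal.prod_normalizedFactors_eq_self (hne I), hk, ← Multiset.prod_replicate]
      exact Multiset.prod_dvd_prod_of_le (Multiset.le_count_iff_replicate_le.mp le_rfl)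
    have h2 := map_dvd Ideal.absNorm h1
    rw [map_pow, I.2] at h2
    rcases Nat.eq_zero_or_pos k with h0 | h0
    · omega
    obtain ⟨j, -, hj⟩ := (Nat.dvd_prime_pow hp).mp ((dvd_pow_self _ h0.ne').trans h2)
    rw [hj, ← pow_mul, Nat.pow_dvd_pow_iff_le_right hp.one_lt] at h2
    have hj0 : j ≠ 0 := by
      rintro rfl
      exact P.2.1.ne_top (Ideal.absNorm_eq_one_iff.mp (by simpa using hj))
    exact (Nat.le_mul_of_pos_left k (Nat.pos_of_ne_zero hj0)).trans h2⟩
  have hc : Function.Injective c := by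
    have hzero : ∀ (I : {I : Ideal (𝓞 E) // Ideal.absNorm I = p ^ e}) (P : Ideal (𝓞 E)),
        P ∉ 𝔭.primesOver (𝓞 E) → (UniqueFactorizationMonoid.normalizedFactors I.1).count P = 0 := by
      intro I P hP
      rw [Multiset.count_eq_zero]
      intro hmem
      rw [Ideal.mem_normalizedFactors_iff (hne I)] at hmem
      have h1 : ((p ^ e : ℕ) : 𝓞 E) ∈ P := hmem.2 (natCast_mem_of_absNorm_dvd I.2.dvd)
      push_cast at h1
      refine hP ⟨hmem.1, (Ideal.liesOver_span_iff hmem.1.ne_top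
        (Nat.prime_iff_prime_int.mp hp)).mpr ?_⟩
      simpa using hmem.1.mem_of_pow_mem _ h1
    intro I J hIJ
    apply Subtype.ext
    rw [← Ideal.prod_normalizedFactors_eq_self (hne I), ← Ideal.prod_normalizedFactors_eq_self (hne J)]
    congr 1
    ext P
    by_cases hP : P ∈ 𝔭.primesOver (𝓞 E)
    · exact congrArg Fin.val (congrFun hIJ ⟨P, hP⟩)
    · rw [hzero I P hP, hzero J P hP]
  calc zetaCoeff E (p ^ e) ≤ Nat.card (𝔭.primesOver (𝓞 E) → Fin (e + 1)) :=
        Nat.card_le_card_of_injective c hc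
    _ = (e + 1) ^ Nat.card (𝔭.primesOver (𝓞 E)) := by simp
    _ ≤ _ := Nat.pow_le_pow_right e.succ_pos hcard

end ZetaCoeff

end

end ArithEquiv

namespace ArithEquiv

noncomputable section

open NumberField Filter Topology

/-! ### Euler product and the pole of the Dedekind zeta function at 1. -/

section Analytic

theorem summable_add_three_pow_mul_geometric (d : ℕ) :
    Summable fun e : ℕ ↦ ((e : ℝ) + 3) ^ d * (1 / 2) ^ e := by
  have h := summable_pow_mul_geometric_of_norm_lt_one (R := ℝ) d (r := 1 / 2) (by norm_num)
  -- The factor 8 compensates for `(1 / 2) ^ 3` in the shifted series.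
  refine (((summable_nat_add_iff 3).mpr h).mul_left 8).congr fun e ↦ ?_
  push_cast
  ring

/-- The tail of an Euler factor whose coefficients grow at most like `(e + 1) ^ d`. -/
def eulerTailBound (d : ℕ) : ℝ := ∑' e : ℕ, ((e : ℝ) + 3) ^ d * (1 / 2) ^ e

theorem eulerTailBound_nonneg (d : ℕ) : 0 ≤ eulerTailBound d :=
  tsum_nonneg fun _ ↦ by positivity

/-- The error constant in `log F = a₁ x + O(x²)`. -/
def eulerLogBound (d : ℕ) : ℝ := eulerTailBound d + (2 ^ d + eulerTailBound d) ^ 2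

/-- The factor is `1 + y` with `y = a 1 * x + x ^ 2 * R`, where `R` is bounded, and `y - y ^ 2 ≤ log
(1 + y) ≤ y`. The error constant depends only on `d`, hence is uniform over all primes. -/
theorem log_eulerFactor {a : ℕ → ℝ} {d : ℕ} (h0 : a 0 = 1) (hpos : ∀ e, 0 ≤ a e)
    (hle : ∀ e : ℕ, a e ≤ ((e : ℝ) + 1) ^ d) {x : ℝ} (hx0 : 0 ≤ x) (hx : x ≤ 1 / 2) :
    0 < ∑' e, a e * x ^ e ∧
      |Real.log (∑' e, a e * x ^ e) - a 1 * x| ≤ eulerLogBound d * x ^ 2 := by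
  have htail_le : ∀ e : ℕ, a (e + 2) * x ^ e ≤ ((e : ℝ) + 3) ^ d * (1 / 2) ^ e := fun e ↦ by
    have := hle (e + 2)
    push_cast at this
    have h3 : (e : ℝ) + 2 + 1 = e + 3 := by ring
    rw [h3] at this
    gcongr
  have htail : Summable fun e ↦ a (e + 2) * x ^ e :=
    .of_nonneg_of_le (fun e ↦ mul_nonneg (hpos _) (pow_nonneg hx0 _)) htail_le
      (summable_add_three_pow_mul_geometric d)
  have hsum : Summable fun e ↦ a e * x ^ e :=
    (summable_nat_add_iff 2).mp ((htail.mul_left (x ^ 2)).congr fun e ↦ by ring)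
  set R := ∑' e, a (e + 2) * x ^ e with hR
  have hR0 : 0 ≤ R := tsum_nonneg fun e ↦ mul_nonneg (hpos _) (pow_nonneg hx0 _)
  have hRB : R ≤ eulerTailBound d :=
    htail.tsum_le_tsum htail_le (summable_add_three_pow_mul_geometric d)
  have hF : ∑' e, a e * x ^ e = 1 + (a 1 * x + x ^ 2 * R) := by
    rw [← hsum.sum_add_tsum_nat_add 2, hR, ← tsum_mul_left]
    simp only [Finset.sum_range_succ, Finset.sum_range_zero, h0]
    rw [show (fun e ↦ a (e + 2) * x ^ (e + 2)) = fun e ↦ x ^ 2 * (a (e + 2) * x ^ e) from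
      funext fun e ↦ by ring]
    ring
  set y := a 1 * x + x ^ 2 * R with hy
  have ha1 : a 1 ≤ 2 ^ d := by
    have := hle 1
    norm_num at this
    exact this
  have hy0 : 0 ≤ y := by have := hpos 1; positivity
  have hyle : y ≤ (2 ^ d + eulerTailBound d) * x := by
    have h1 : a 1 * x ≤ 2 ^ d * x := by gcongr
    have h2 : x ^ 2 * R ≤ x * eulerTailBound d := by
      have : x ^ 2 ≤ x := by nlinarith
      gcongr
    linarith
  have hy2 : y ^ 2 ≤ (2 ^ d + eulerTailBound d) ^ 2 * x ^ 2 := by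
    rw [← mul_pow]
    gcongr
  have hxR : x ^ 2 * R ≤ eulerTailBound d * x ^ 2 := by
    rw [mul_comm]
    gcongr
  have hup : Real.log (1 + y) ≤ y := by
    have := Real.log_le_sub_one_of_pos (show 0 < 1 + y by linarith)
    linarith
  have hlow : y - y ^ 2 ≤ Real.log (1 + y) := by
    refine le_trans ?_ (Real.one_sub_inv_le_log_of_pos (show 0 < 1 + y by linarith))
    -- Indeed `(1 + y) * (1 - y + y ^ 2) = 1 + y ^ 3`.
    have : (1 + y)⁻¹ ≤ 1 - y + y ^ 2 := by
      rw [inv_le_iff_one_le_mul₀ (by linarith)]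
      nlinarith [pow_nonneg hy0 3]
    linarith
  rw [hF]
  refine ⟨by linarith, ?_⟩
  have hnn : 0 ≤ x ^ 2 * R := by positivity
  have hT := eulerTailBound_nonneg d
  have hTx : 0 ≤ eulerTailBound d * x ^ 2 := by positivity
  have hQx : 0 ≤ (2 ^ d + eulerTailBound d) ^ 2 * x ^ 2 := by positivity
  rw [abs_le, eulerLogBound, add_mul]
  constructor <;> linarith

variable (E : Type*) [Field E] [NumberField E]

/-- The Dedekind zeta function at a real point, as a real series. -/
def realZeta (s : ℝ) : ℝ := ∑' n : ℕ, (zetaCoeff E n : ℝ) * (n : ℝ) ^ (-s)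

theorem dedekindZeta_eq_realZeta {s : ℝ} (hs : 1 < s) :
    dedekindZeta E s = (realZeta E s : ℂ) := by
  rw [dedekindZeta, LSeries, realZeta, Complex.ofReal_tsum]
  refine tsum_congr fun n ↦ ?_
  rcases eq_or_ne n 0 with rfl | hn
  -- The zero ideal makes the coefficient at 0 equal to 1; the term vanishes only because `0 ^ (-s)
  -- = 0`.
  · simp [Real.zero_rpow (show -s ≠ 0 by linarith)]
  · rw [LSeries.term_of_ne_zero hn, Complex.ofReal_mul, Complex.ofReal_cpow n.cast_nonneg,
      Complex.ofReal_neg, Complex.cpow_neg, div_eq_mul_inv]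
    simp [zetaCoeff]

theorem tendsto_sub_one_mul_realZeta :
    Tendsto (fun s : ℝ ↦ (s - 1) * realZeta E s) (𝓝[>] 1) (𝓝 (dedekindZeta_residue E)) := by
  have h := tendsto_sub_one_mul_dedekindZeta_nhdsGT E
  have h' := (Complex.continuous_re.tendsto _).comp h
  rw [Complex.ofReal_re] at h'
  refine h'.congr' ?_
  filter_upwards [self_mem_nhdsWithin] with s hs
  rw [Function.comp_apply, dedekindZeta_eq_realZeta E hs]
  norm_cast

theorem eventually_realZeta_pos : ∀ᶠ s in 𝓝[>] (1 : ℝ), 0 < realZeta E s := by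
  filter_upwards [(tendsto_sub_one_mul_realZeta E).eventually_const_lt
    (dedekindZeta_residue_pos E), self_mem_nhdsWithin] with s hs hs1
  exact pos_of_mul_pos_right hs (sub_nonneg.mpr (le_of_lt hs1))

/-- A divergent `tsum` is 0 by convention, so positivity, which the pole supplies near 1, already
yields convergence. -/
theorem summable_zetaCoeff_of_realZeta_pos {s : ℝ} (h : 0 < realZeta E s) :
    Summable fun n : ℕ ↦ (zetaCoeff E n : ℝ) * (n : ℝ) ^ (-s) := by
  by_contra hn
  rw [realZeta, tsum_eq_zero_of_not_summable hn] at h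
  exact lt_irrefl _ h

/-- The Dirichlet series `∑_p c_p p ^ (-s)` over the rational primes. -/
def primeSum (c : Nat.Primes → ℝ) (s : ℝ) : ℝ := ∑' p : Nat.Primes, c p * (p : ℝ) ^ (-s)

theorem hasProd_eulerFactor {s : ℝ} (hs : 1 < s) (h : 0 < realZeta E s) :
    HasProd (fun p : Nat.Primes ↦ ∑' e, (zetaCoeff E (p ^ e) : ℝ) * ((p : ℝ) ^ (-s)) ^ e)
      (realZeta E s) := by
  have hsum := summable_zetaCoeff_of_realZeta_pos E h
  have hs0 : -s ≠ 0 := by linarith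
  have := EulerProduct.eulerProduct_hasProd
    (f := fun n : ℕ ↦ (zetaCoeff E n : ℝ) * (n : ℝ) ^ (-s)) (by simp [zetaCoeff_one])
    (fun {m n} hmn ↦ by
      rcases eq_or_ne m 0 with rfl | hm
      · simp [Real.zero_rpow hs0]
      rcases eq_or_ne n 0 with rfl | hn
      · simp [Real.zero_rpow hs0]
      simp only [zetaCoeff_mul_of_coprime E hmn hm hn, Nat.cast_mul,
        Real.mul_rpow m.cast_nonneg n.cast_nonneg]
      ring) hsum.norm (by simp [Real.zero_rpow hs0])
  refine (congrArg (HasProd · (realZeta E s)) (funext fun p ↦ tsum_congr fun e ↦ ?_)).mpr this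
  rw [Nat.cast_pow, ← Real.rpow_natCast, ← Real.rpow_natCast, ← Real.rpow_mul p.1.cast_nonneg,
    ← Real.rpow_mul p.1.cast_nonneg, mul_comm (-s)]

theorem abs_log_realZeta_sub_primeSum_le {s : ℝ} (hs : 1 < s) (h : 0 < realZeta E s) :
    |Real.log (realZeta E s) - primeSum (fun p ↦ zetaCoeff E p) s| ≤
      eulerLogBound (Module.finrank ℤ (𝓞 E)) * ∑' p : Nat.Primes, (p : ℝ) ^ (-2 : ℝ) := by
  set d := Module.finrank ℤ (𝓞 E)
  set F : Nat.Primes → ℝ := fun p ↦ ∑' e, (zetaCoeff E (p ^ e) : ℝ) * ((p : ℝ) ^ (-s)) ^ e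
  have hC : 0 ≤ eulerLogBound d := by
    have := eulerTailBound_nonneg d
    rw [eulerLogBound]
    positivity
  have hp1 : ∀ p : Nat.Primes, (p : ℝ) ^ (-s) ≤ (p : ℝ) ^ (-1 : ℝ) := fun p ↦
    Real.rpow_le_rpow_of_exponent_le (by exact_mod_cast p.2.one_lt.le) (by linarith)
  have key : ∀ p : Nat.Primes, 0 < F p ∧
      |Real.log (F p) - zetaCoeff E p * (p : ℝ) ^ (-s)| ≤ eulerLogBound d * (p : ℝ) ^ (-2 : ℝ) := by
    intro p
    have hp2 : (2 : ℝ) ≤ p := by exact_mod_cast p.2.two_le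
    have := log_eulerFactor (a := fun e ↦ zetaCoeff E (p ^ e)) (d := d) (x := (p : ℝ) ^ (-s))
      (by simp [zetaCoeff_one]) (fun e ↦ Nat.cast_nonneg _)
      (fun e ↦ by exact_mod_cast zetaCoeff_prime_pow_le E p.2 e) (by positivity)
      ((hp1 p).trans (by rw [Real.rpow_neg_one, one_div]; gcongr))
    rw [pow_one] at this
    refine ⟨this.1, this.2.trans ?_⟩
    gcongr
    calc ((p : ℝ) ^ (-s)) ^ 2 ≤ ((p : ℝ) ^ (-1 : ℝ)) ^ 2 :=
          pow_le_pow_left₀ (by positivity) (hp1 p) 2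
      _ = (p : ℝ) ^ (-2 : ℝ) := by
        rw [← Real.rpow_natCast, ← Real.rpow_mul (by positivity)]; norm_num
  have hp2 : Summable fun p : Nat.Primes ↦ eulerLogBound d * (p : ℝ) ^ (-2 : ℝ) :=
    (Nat.Primes.summable_rpow.mpr (by norm_num)).mul_left _
  have hdiff : Summable fun p : Nat.Primes ↦
      Real.log (F p) - zetaCoeff E p * (p : ℝ) ^ (-s) :=
    .of_norm_bounded (g := fun p ↦ eulerLogBound d * (p : ℝ) ^ (-2 : ℝ)) hp2 fun p ↦ (key p).2
  have hps : Summable fun p : Nat.Primes ↦ (zetaCoeff E p : ℝ) * (p : ℝ) ^ (-s) :=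
    (summable_zetaCoeff_of_realZeta_pos E h).comp_injective Subtype.val_injective
  have hlog : Summable fun p : Nat.Primes ↦ Real.log (F p) :=
    (hdiff.add hps).congr fun p ↦ by ring
  have hprod := Real.hasProd_of_hasSum_log (fun p ↦ (key p).1) hlog.hasSum
  have hz : Real.log (realZeta E s) = ∑' p : Nat.Primes, Real.log (F p) := by
    rw [(hasProd_eulerFactor E hs h).unique hprod, Real.log_exp]
  rw [hz, primeSum, ← hlog.tsum_sub hps, ← tsum_mul_left]
  exact tsum_of_norm_bounded (f := fun p : Nat.Primes ↦ Real.log (F p) -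
    zetaCoeff E p * (p : ℝ) ^ (-s)) hp2.hasSum fun p ↦ (key p).2

theorem tendsto_neg_log_sub_one :
    Tendsto (fun s : ℝ ↦ -Real.log (s - 1)) (𝓝[>] 1) atTop := by
  have h : Tendsto (fun s : ℝ ↦ s - 1) (𝓝[>] 1) (𝓝[>] 0) := by
    refine tendsto_nhdsWithin_iff.mpr ⟨?_, ?_⟩
    · exact tendsto_nhdsWithin_of_tendsto_nhds
        (Continuous.tendsto' (by fun_prop) _ _ (by norm_num))
    · filter_upwards [self_mem_nhdsWithin] with s hs
      exact sub_pos.mpr (Set.mem_Ioi.mp hs)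
  exact tendsto_neg_atBot_atTop.comp (Real.tendsto_log_nhdsGT_zero.comp h)

/-- Up to a bounded error the prime sum is `log ζ_E(s) = -log (s - 1) + log ((s - 1) ζ_E(s))`, and
the last term tends to the logarithm of the residue. -/
theorem tendsto_primeSum_zetaCoeff_div_log :
    Tendsto (fun s : ℝ ↦ primeSum (fun p ↦ zetaCoeff E p) s / -Real.log (s - 1))
      (𝓝[>] 1) (𝓝 1) := by
  set D := eulerLogBound (Module.finrank ℤ (𝓞 E)) * ∑' p : Nat.Primes, (p : ℝ) ^ (-2 : ℝ)
  have hlog : Tendsto (fun s : ℝ ↦ Real.log ((s - 1) * realZeta E s)) (𝓝[>] 1)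
      (𝓝 (Real.log (dedekindZeta_residue E))) :=
    (Real.continuousAt_log (dedekindZeta_residue_ne_zero E)).tendsto.comp
      (tendsto_sub_one_mul_realZeta E)
  have h0 : Tendsto (fun s : ℝ ↦
      (primeSum (fun p ↦ zetaCoeff E p) s - -Real.log (s - 1)) / -Real.log (s - 1))
      (𝓝[>] 1) (𝓝 0) := by
    refine squeeze_zero_norm' (a := fun s ↦ (D + |Real.log ((s - 1) * realZeta E s)|) /
      -Real.log (s - 1)) ?_ ((tendsto_const_nhds.add hlog.abs).div_atTop tendsto_neg_log_sub_one)
    filter_upwards [eventually_realZeta_pos E, self_mem_nhdsWithin,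
      tendsto_neg_log_sub_one.eventually_gt_atTop 0] with s hz hs hl
    rw [norm_div, Real.norm_of_nonneg hl.le]
    gcongr
    have h1 := abs_log_realZeta_sub_primeSum_le E hs hz
    rw [abs_sub_comm] at h1
    have h2 : primeSum (fun p ↦ zetaCoeff E p) s - -Real.log (s - 1) =
        (primeSum (fun p ↦ zetaCoeff E p) s - Real.log (realZeta E s)) +
          Real.log ((s - 1) * realZeta E s) := by
      rw [Real.log_mul (sub_pos.mpr hs).ne' hz.ne']
      ring
    rw [h2]
    exact (norm_add_le _ _).trans (add_le_add_left h1 _)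
  have h1 := h0.add_const 1
  rw [zero_add] at h1
  refine h1.congr' ?_
  filter_upwards [tendsto_neg_log_sub_one.eventually_gt_atTop 0] with s hl
  rw [sub_div, div_self hl.ne', sub_add_cancel]

end Analytic

end

end ArithEquiv

namespace ArithEquiv

noncomputable section

open NumberField Filter Topology

/-! ### Mean values over primes and Dirichlet density. -/

section Density

theorem absNorm_primesEquiv_symm (p : Nat.Primes) :
    Ideal.absNorm ((Rat.HeightOneSpectrum.primesEquiv (R := 𝓞 ℚ)).symm p).asIdeal = p := by
  set v := (Rat.HeightOneSpectrum.primesEquiv (R := 𝓞 ℚ)).symm p with hv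
  have h1 : Rat.HeightOneSpectrum.natGenerator v = p :=
    congrArg Subtype.val ((Rat.HeightOneSpectrum.primesEquiv (R := 𝓞 ℚ)).apply_symm_apply p)
  have h2 := Rat.HeightOneSpectrum.span_natGenerator v
  rw [h1] at h2
  have e := Ideal.quotientEquiv v.asIdeal (Ideal.span {(p : ℤ)})
    (Rat.IsIntegralClosure.intEquiv (𝓞 ℚ)) h2
  rw [Ideal.absNorm_apply, Submodule.cardQuot_apply, Nat.card_congr e.toEquiv, Int.card_ideal_quot]

/-- With `E = ℚ`, the zeta asymptotics become those of the denominator `∑ p ^ (-s)`. -/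
theorem zetaCoeff_rat (p : Nat.Primes) : zetaCoeff ℚ p = 1 := by
  rw [zetaCoeff, Nat.card_eq_one_iff_exists]
  refine ⟨⟨_, absNorm_primesEquiv_symm p⟩, fun ⟨I, hI⟩ ↦ Subtype.ext ?_⟩
  have hprime : I.IsPrime := Ideal.isPrime_of_irreducible_absNorm (hI ▸ p.2)
  have hbot : I ≠ ⊥ := fun h ↦ p.2.ne_zero (by rw [← hI, h, Ideal.absNorm_bot])
  obtain ⟨q, hq⟩ := (Rat.HeightOneSpectrum.primesEquiv (R := 𝓞 ℚ)).symm.surjective ⟨I, hprime, hbot⟩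
  have hq' : ((Rat.HeightOneSpectrum.primesEquiv (R := 𝓞 ℚ)).symm q).asIdeal = I := by rw [hq]
  have : q = p := Subtype.ext (by rw [← absNorm_primesEquiv_symm q, hq', hI])
  exact hq'.symm.trans (by rw [this])

/-- The weight function `c` on primes has Dirichlet mean value `ℓ`. -/
def HasMean (c : Nat.Primes → ℝ) (ℓ : ℝ) : Prop :=
  Tendsto (fun s ↦ primeSum c s / primeSum 1 s) (𝓝[>] 1) (𝓝 ℓ)

/-- A weight function on primes with bounded values. -/
def IsBdd (c : Nat.Primes → ℝ) : Prop := ∃ B, ∀ p, |c p| ≤ B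

variable {c c' : Nat.Primes → ℝ} {ℓ ℓ' : ℝ}

theorem IsBdd.summable (hc : IsBdd c) {s : ℝ} (hs : 1 < s) :
    Summable fun p : Nat.Primes ↦ c p * (p : ℝ) ^ (-s) := by
  obtain ⟨B, hB⟩ := hc
  refine .of_norm_bounded (g := fun p : Nat.Primes ↦ B * (p : ℝ) ^ (-s))
    ((Nat.Primes.summable_rpow.mpr (by linarith)).mul_left _) fun p ↦ ?_
  rw [norm_mul, Real.norm_of_nonneg (r := (p : ℝ) ^ (-s)) (by positivity)]
  gcongr
  exact hB p

theorem isBdd_comp {G : Type*} [Finite G] (F : G → ℝ) (φ : Nat.Primes → G) :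
    IsBdd fun p ↦ F (φ p) := by
  obtain ⟨B, hB⟩ := (Set.finite_range fun g ↦ |F g|).bddAbove
  exact ⟨B, fun p ↦ hB ⟨φ p, rfl⟩⟩

theorem isBdd_zetaCoeff (E : Type*) [Field E] [NumberField E] :
    IsBdd fun p ↦ zetaCoeff E p := by
  refine ⟨2 ^ Module.finrank ℤ (𝓞 E), fun p ↦ ?_⟩
  rw [abs_of_nonneg (by positivity)]
  have := zetaCoeff_prime_pow_le E p.2 1
  rw [pow_one] at this
  calc (zetaCoeff E p : ℝ) ≤ ((1 + 1) ^ Module.finrank ℤ (𝓞 E) : ℕ) := by exact_mod_cast this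
    _ = _ := by norm_num

theorem primeSum_add (hc : IsBdd c) (hc' : IsBdd c') {s : ℝ} (hs : 1 < s) :
    primeSum (c + c') s = primeSum c s + primeSum c' s := by
  rw [primeSum, primeSum, primeSum, ← (hc.summable hs).tsum_add (hc'.summable hs)]
  exact tsum_congr fun p ↦ by rw [Pi.add_apply, add_mul]

theorem primeSum_smul (a : ℝ) (s : ℝ) : primeSum (a • c) s = a * primeSum c s := by
  rw [primeSum, primeSum, ← tsum_mul_left]
  exact tsum_congr fun p ↦ by rw [Pi.smul_apply, smul_eq_mul, mul_assoc]

theorem tendsto_primeSum_one_div_log :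
    Tendsto (fun s : ℝ ↦ primeSum 1 s / -Real.log (s - 1)) (𝓝[>] 1) (𝓝 1) := by
  have := tendsto_primeSum_zetaCoeff_div_log ℚ
  simp only [zetaCoeff_rat, Nat.cast_one] at this
  exact this

theorem tendsto_primeSum_one : Tendsto (primeSum 1) (𝓝[>] 1) atTop := by
  refine (tendsto_primeSum_one_div_log.pos_mul_atTop one_pos tendsto_neg_log_sub_one).congr' ?_
  filter_upwards [tendsto_neg_log_sub_one.eventually_gt_atTop 0] with s hl
  exact div_mul_cancel₀ _ hl.ne'

theorem hasMean_zetaCoeff (E : Type*) [Field E] [NumberField E] :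
    HasMean (fun p ↦ zetaCoeff E p) 1 := by
  have := (tendsto_primeSum_zetaCoeff_div_log E).div tendsto_primeSum_one_div_log one_ne_zero
  rw [div_one] at this
  refine this.congr' ?_
  filter_upwards [tendsto_neg_log_sub_one.eventually_gt_atTop 0] with s hl
  exact div_div_div_cancel_right₀ hl.ne' _ _

theorem HasMean.add (h : HasMean c ℓ) (h' : HasMean c' ℓ') (hc : IsBdd c) (hc' : IsBdd c') :
    HasMean (c + c') (ℓ + ℓ') := by
  refine (Tendsto.add h h').congr' ?_
  filter_upwards [self_mem_nhdsWithin] with s hs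
  rw [primeSum_add hc hc' hs, add_div]

theorem HasMean.smul (h : HasMean c ℓ) (a : ℝ) : HasMean (a • c) (a * ℓ) := by
  refine (Tendsto.const_mul a h).congr fun s ↦ ?_
  rw [primeSum_smul, mul_div_assoc]

theorem HasMean.mono (h : HasMean c ℓ) (h' : HasMean c' ℓ') (hc : IsBdd c) (hc' : IsBdd c')
    (hle : c ≤ c') : ℓ ≤ ℓ' := by
  refine le_of_tendsto_of_tendsto h h' ?_
  filter_upwards [self_mem_nhdsWithin] with s hs
  refine div_le_div_of_nonneg_right ?_ (tsum_nonneg fun p ↦ ?_)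
  · exact (hc.summable hs).tsum_le_tsum
      (fun p ↦ mul_le_mul_of_nonneg_right (hle p) (by positivity)) (hc'.summable hs)
  · simp only [Pi.one_apply, one_mul]
    positivity

theorem HasMean.unique (h : HasMean c ℓ) (h' : HasMean c ℓ') : ℓ = ℓ' :=
  tendsto_nhds_unique h h'

theorem hasMean_zero_of_finite_support (h : (Function.support c).Finite) : HasMean c 0 := by
  have hsum : ∀ s, primeSum c s = ∑ p ∈ h.toFinset, c p * (p : ℝ) ^ (-s) := fun s ↦
    tsum_eq_sum fun p hp ↦ by
      rw [Set.Finite.mem_toFinset, Function.mem_support, not_not] at hp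
      rw [hp, zero_mul]
  refine squeeze_zero_norm' (a := fun s ↦ (∑ p ∈ h.toFinset, |c p|) / primeSum 1 s) ?_
    (tendsto_const_nhds.div_atTop tendsto_primeSum_one)
  filter_upwards [self_mem_nhdsWithin, tendsto_primeSum_one.eventually_gt_atTop 0] with s hs hp
  rw [norm_div, Real.norm_of_nonneg hp.le, hsum]
  gcongr
  refine (norm_sum_le _ _).trans (Finset.sum_le_sum fun p _ ↦ ?_)
  rw [norm_mul, Real.norm_of_nonneg (r := (p : ℝ) ^ (-s)) (by positivity)]
  refine mul_le_of_le_one_right (norm_nonneg _) (Real.rpow_le_one_of_one_le_of_nonpos ?_ ?_)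
  · exact_mod_cast p.2.one_lt.le
  · have := Set.mem_Ioi.mp hs
    linarith

theorem HasMean.congr_finite (h : HasMean c ℓ) (hc : IsBdd c)
    (hfin : {p | c p ≠ c' p}.Finite) : HasMean c' ℓ := by
  have hsupp : Function.support (c' - c) ⊆ {p | c p ≠ c' p} := fun p hp ↦ by
    rw [Function.mem_support, Pi.sub_apply, sub_ne_zero] at hp
    exact hp.symm
  have hd : (Function.support (c' - c)).Finite := hfin.subset hsupp
  have hbd : IsBdd (c' - c) := by
    obtain ⟨B, hB⟩ := (hd.image fun p ↦ |(c' - c) p|).bddAbove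
    refine ⟨max B 0, fun p ↦ ?_⟩
    by_cases hp : (c' - c) p = 0
    · rw [hp, abs_zero]
      exact le_max_right _ _
    · exact (hB ⟨p, hp, rfl⟩).trans (le_max_left _ _)
  have := h.add (hasMean_zero_of_finite_support hd) hc hbd
  rwa [add_sub_cancel, add_zero] at this

theorem hasDensity_iff_hasMean_indicator (S : Set Nat.Primes) (d : ℝ) :
    HasDensity S d ↔ HasMean (S.indicator 1) d := by
  have key : ∀ (S : Set Nat.Primes) (s : ℝ), NumberField.Set.primeIdealZetaSum
      ((Rat.HeightOneSpectrum.primesEquiv (R := 𝓞 ℚ)) ⁻¹' S) s = primeSum (S.indicator 1) s := by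
    intro S s
    rw [NumberField.Set.primeIdealZetaSum_def, primeSum,
      tsum_subtype ((Rat.HeightOneSpectrum.primesEquiv (R := 𝓞 ℚ)) ⁻¹' S)
        (fun v ↦ (Ideal.absNorm v.asIdeal : ℝ) ^ (-s)),
      ← (Rat.HeightOneSpectrum.primesEquiv (R := 𝓞 ℚ)).symm.tsum_eq]
    refine tsum_congr fun p ↦ ?_
    by_cases hp : p ∈ S
    · rw [Set.indicator_of_mem (by simpa using hp), Set.indicator_of_mem hp,
        absNorm_primesEquiv_symm, Pi.one_apply, one_mul]
    · rw [Set.indicator_of_notMem (by simpa using hp), Set.indicator_of_notMem hp, zero_mul]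
  have huniv := key Set.univ
  rw [Set.preimage_univ, Set.indicator_univ] at huniv
  rw [HasDensity, NumberField.Set.HasDirichletDensity, HasMean]
  exact iff_of_eq (congrArg (Tendsto · _ _) (funext fun s ↦ by rw [key, huniv]))

end Density

end

end ArithEquiv

namespace ArithEquiv

noncomputable section

open MulAction

/-! ### Permutation characters and the functions they span. -/

section PermutationCharacters

variable {G : Type*} [Group G]

/-- The permutation character of `G` on `G ⧸ H`. -/
def permChar (H : Subgroup G) (g : G) : ℝ := Nat.card (fixedBy (G ⧸ H) g)

/-- Functions constant on divisions: the value at `g` depends only on the conjugacy class of the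
cyclic subgroup generated by `g`. -/
def ConstOnDivisions (F : G → ℝ) : Prop :=
  ∀ g g' x : G, Subgroup.zpowers (x * g * x⁻¹) = Subgroup.zpowers g' → F g = F g'

theorem fixedBy_subset_of_mem_zpowers {α : Type*} [MulAction G α] {g h : G}
    (hh : h ∈ Subgroup.zpowers g) : fixedBy α g ⊆ fixedBy α h := by
  intro a ha
  have : Subgroup.zpowers g ≤ stabilizer G a := by
    rw [Subgroup.zpowers_le]
    exact ha
  exact this hh

theorem permChar_constOnDivisions (H : Subgroup G) : ConstOnDivisions (permChar H) := by
  intro g g' x h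
  have h1 : fixedBy (G ⧸ H) (x * g * x⁻¹) = fixedBy (G ⧸ H) g' :=
    (fixedBy_subset_of_mem_zpowers (h ▸ Subgroup.mem_zpowers g')).antisymm
      (fixedBy_subset_of_mem_zpowers (h ▸ Subgroup.mem_zpowers (x * g * x⁻¹)))
  rw [permChar, permChar, ← h1, ← smul_fixedBy]
  congr 1
  exact Nat.card_congr (Equiv.Set.image _ _ (MulAction.injective x))

theorem mk_mem_fixedBy_iff {H : Subgroup G} {g x : G} :
    (x : G ⧸ H) ∈ fixedBy (G ⧸ H) g ↔ x⁻¹ * g * x ∈ H := by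
  rw [mem_fixedBy, Quotient.smul_coe, smul_eq_mul, eq_comm, QuotientGroup.eq, mul_assoc]

theorem exists_of_permChar_ne_zero {H : Subgroup G} {g : G} (h : permChar H g ≠ 0) :
    ∃ x, x⁻¹ * g * x ∈ H := by
  have : Nonempty (fixedBy (G ⧸ H) g) := by
    by_contra hn
    rw [not_nonempty_iff] at hn
    exact h (by rw [permChar, Nat.card_of_isEmpty, Nat.cast_zero])
  obtain ⟨⟨a, ha⟩⟩ := this
  obtain ⟨x, rfl⟩ := QuotientGroup.mk_surjective a
  exact ⟨x, mk_mem_fixedBy_iff.mp ha⟩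

theorem orderOf_conj_inv (x g : G) : orderOf (x⁻¹ * g * x) = orderOf g := by
  have := (MulAut.conj x⁻¹).orderOf_eq g
  rwa [MulAut.conj_apply, inv_inv] at this

theorem permChar_nonneg (H : Subgroup G) (g : G) : 0 ≤ permChar H g := Nat.cast_nonneg _

theorem permChar_of_normal (N : Subgroup G) [N.Normal] [DecidablePred (· ∈ N)] (g : G) :
    permChar N g = if g ∈ N then (N.index : ℝ) else 0 := by
  have hmem : ∀ x : G, x⁻¹ * g * x ∈ N ↔ g ∈ N := fun x ↦ by
    rw [mul_assoc, ← Subgroup.Normal.mem_comm_iff ‹_›, mul_assoc, mul_inv_cancel, mul_one]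
  split_ifs with h
  · have : fixedBy (G ⧸ N) g = Set.univ := Set.eq_univ_of_forall fun a ↦ by
      obtain ⟨x, rfl⟩ := QuotientGroup.mk_surjective a
      exact mk_mem_fixedBy_iff.mpr ((hmem x).mpr h)
    rw [permChar, this, Nat.card_univ, Subgroup.index]
  · by_contra hn
    obtain ⟨x, hx⟩ := exists_of_permChar_ne_zero hn
    exact h ((hmem x).mp hx)

variable [Finite G]

/-- Characters of cyclic subgroups are triangular with respect to element order: a nonzero value
puts a conjugate of `x` into `⟨g⟩`. -/
theorem permChar_zpowers_eq_zero {g x : G} (h : orderOf g < orderOf x) :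
    permChar (Subgroup.zpowers g) x = 0 := by
  by_contra hn
  obtain ⟨y, hy⟩ := exists_of_permChar_ne_zero hn
  have := orderOf_dvd_of_mem_zpowers hy
  rw [orderOf_conj_inv] at this
  exact absurd (Nat.le_of_dvd (orderOf_pos g) this) (not_le.mpr h)

theorem zpowers_conj_eq_of_permChar_ne_zero {g x : G} (h : orderOf g = orderOf x)
    (hn : permChar (Subgroup.zpowers g) x ≠ 0) :
    ∃ y, Subgroup.zpowers (y * x * y⁻¹) = Subgroup.zpowers g := by
  obtain ⟨y, hy⟩ := exists_of_permChar_ne_zero hn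
  refine ⟨y⁻¹, ?_⟩
  rw [inv_inv]
  refine Subgroup.eq_of_le_of_card_ge (Subgroup.zpowers_le.mpr hy) ?_
  rw [Nat.card_zpowers, Nat.card_zpowers, orderOf_conj_inv, h]

theorem permChar_zpowers_self_pos (g : G) : 0 < permChar (Subgroup.zpowers g) g := by
  rw [permChar, Nat.cast_pos, Nat.card_pos_iff]
  refine ⟨⟨⟨((1 : G) : G ⧸ Subgroup.zpowers g), mk_mem_fixedBy_iff.mpr ?_⟩⟩, inferInstance⟩
  simp

/-- Induction on the largest order of an element where `F` is nonzero: a combination of characters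
of cyclic subgroups of that order cancels the top layer. -/
theorem ConstOnDivisions.mem_of_permChar_mem {V : Submodule ℝ (G → ℝ)}
    (hV : ∀ H : Subgroup G, permChar H ∈ V) {F : G → ℝ} (hF : ConstOnDivisions F) : F ∈ V := by
  classical
  have := Fintype.ofFinite G
  suffices ∀ (k : ℕ) (F : G → ℝ), ConstOnDivisions F → (∀ g, k < orderOf g → F g = 0) → F ∈ V by
    obtain ⟨k, hk⟩ := (Set.finite_range (orderOf : G → ℕ)).bddAbove
    exact this k F hF fun g hg ↦ absurd (hk ⟨g, rfl⟩) (not_le.mpr hg)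
  intro k
  induction k with
  | zero =>
    intro F _ h0
    rw [show F = 0 from funext fun g ↦ h0 g (orderOf_pos g)]
    exact V.zero_mem
  | succ k ih =>
    intro F hF h0
    let S : Finset G := Finset.univ.filter fun g ↦ orderOf g = k + 1
    -- `N` corrects for summing over all generators in a division. At `x` of order `k + 1` only `g`
    -- in the division of `x` contribute, and there `F` and `N` take their values at `x`.
    let N (x : G) : ℝ := ∑ g ∈ S, permChar (Subgroup.zpowers g) x
    have hN : ConstOnDivisions N := fun g g' x h ↦
      Finset.sum_congr rfl fun y _ ↦ permChar_constOnDivisions _ g g' x h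
    let F₁ : G → ℝ := ∑ g ∈ S, (F g / N g) • permChar (Subgroup.zpowers g)
    have hF₁ : F₁ ∈ V := V.sum_mem fun g _ ↦ V.smul_mem _ (hV _)
    have hF₁c : ConstOnDivisions F₁ := fun g g' x h ↦ by
      simp only [F₁, Finset.sum_apply, Pi.smul_apply]
      exact Finset.sum_congr rfl fun y _ ↦ by rw [permChar_constOnDivisions _ g g' x h]
    have hsub : F - F₁ ∈ V := by
      refine ih _ (fun g g' x h ↦ ?_) fun x hx ↦ ?_
      · rw [Pi.sub_apply, Pi.sub_apply, hF g g' x h, hF₁c g g' x h]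
      rw [Pi.sub_apply, sub_eq_zero]
      simp only [F₁, Finset.sum_apply, Pi.smul_apply, smul_eq_mul]
      rcases (Nat.succ_le_of_lt hx).eq_or_lt with hxk | hxk
      · have hxS : x ∈ S := Finset.mem_filter.mpr ⟨Finset.mem_univ _, hxk.symm⟩
        have hNx : 0 < N x := Finset.sum_pos' (fun g _ ↦ permChar_nonneg _ _)
          ⟨x, hxS, permChar_zpowers_self_pos x⟩
        have : ∀ g ∈ S, F g / N g * permChar (Subgroup.zpowers g) x =
            F x / N x * permChar (Subgroup.zpowers g) x := by
          intro g hg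
          by_cases hz : permChar (Subgroup.zpowers g) x = 0
          · rw [hz, mul_zero, mul_zero]
          obtain ⟨y, hy⟩ := zpowers_conj_eq_of_permChar_ne_zero
            ((Finset.mem_filter.mp hg).2.trans hxk) hz
          rw [hF x g y hy, hN x g y hy]
        rw [Finset.sum_congr rfl this, ← Finset.mul_sum]
        exact (div_mul_cancel₀ _ hNx.ne').symm
      · rw [h0 x hxk]
        refine (Finset.sum_eq_zero fun g hg ↦ ?_).symm
        rw [permChar_zpowers_eq_zero ((Finset.mem_filter.mp hg).2.trans_lt hxk), mul_zero]
    have := V.add_mem hsub hF₁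
    rwa [sub_add_cancel] at this

/-- The maximal value means that `g` acts trivially on `G ⧸ H`, and the kernel of that action is the
core. -/
theorem permChar_eq_index_iff (H : Subgroup G) (g : G) :
    permChar H g = H.index ↔ g ∈ H.normalCore := by
  rw [permChar, Nat.cast_inj, Subgroup.index, ← Nat.card_univ (α := G ⧸ H), Nat.card_coe_set_eq,
    Nat.card_coe_set_eq]
  have : g ∈ H.normalCore ↔ fixedBy (G ⧸ H) g = Set.univ := by
    rw [Set.eq_univ_iff_forall, (QuotientGroup.mk_surjective (s := H)).forall]
    simp only [mk_mem_fixedBy_iff]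
    exact ⟨fun h x ↦ by simpa using h x⁻¹, fun h x ↦ by simpa using h x⁻¹⟩
  rw [this]
  refine ⟨fun h ↦ Set.eq_of_subset_of_ncard_le (Set.subset_univ _) h.ge, fun h ↦ by rw [h]⟩

end PermutationCharacters

end

end ArithEquiv

namespace ArithEquiv

noncomputable section

open NumberField
open scoped Pointwise

/-! ### Frobenius elements and prime ideals of norm `p`. -/

section Frobenius

variable {M : Type*} [Field M]

theorem card_quotient_under {Q : Ideal (𝓞 M)} {p : ℕ}
    [hQ : Q.LiesOver (Ideal.span {(p : ℤ)})] : Nat.card (ℤ ⧸ Q.under ℤ) = p := by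
  rw [← hQ.over, Int.card_ideal_quot]

variable {E : Type*} [Field E] [Algebra E M]

theorem liesOver_under {Q : Ideal (𝓞 M)} {p : ℕ} [hQ : Q.LiesOver (Ideal.span {(p : ℤ)})] :
    (Q.under (𝓞 E)).LiesOver (Ideal.span {(p : ℤ)}) :=
  ⟨by rw [Ideal.under_under]; exact hQ.over⟩

variable [NumberField M]

theorem isArithFrobAt_int_iff {Q : Ideal (𝓞 M)} {p : ℕ} [Q.LiesOver (Ideal.span {(p : ℤ)})]
    {φ : Gal(M/ℚ)} : IsArithFrobAt ℤ φ Q ↔ ∀ x : 𝓞 M, φ • x - x ^ p ∈ Q := by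
  refine forall_congr' fun x ↦ ?_
  rw [card_quotient_under (p := p)]
  rfl

theorem IsArithFrobAt.eq_of_isUnramifiedIn [IsGalois ℚ M] {Q : Ideal (𝓞 M)} [Q.IsPrime] {p : ℕ}
    [Q.LiesOver (Ideal.span {(p : ℤ)})]
    (hp : Algebra.IsUnramifiedIn (𝓞 M) (Ideal.span {(p : ℤ)})) {φ ψ : Gal(M/ℚ)}
    (hφ : IsArithFrobAt ℤ φ Q) (hψ : IsArithFrobAt ℤ ψ Q) : φ = ψ := by
  have := hp Q inferInstance inferInstance
  have h := AlgHom.IsArithFrobAt.eq_of_isUnramifiedAt hφ hψ Q.primeCompl_le_nonZeroDivisors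
  have : FaithfulSMul Gal(M/ℚ) (𝓞 M) := IsGaloisGroup.faithful ℤ
  exact FaithfulSMul.eq_of_smul_eq_smul fun x : 𝓞 M ↦ DFunLike.congr_fun h x

theorem smul_mem_iff_of_mem_stabilizer {Q : Ideal (𝓞 M)} {d : Gal(M/ℚ)}
    (hd : d ∈ MulAction.stabilizer Gal(M/ℚ) Q) {x : 𝓞 M} : d • x ∈ Q ↔ x ∈ Q := by
  conv_lhs => rw [← MulAction.mem_stabilizer_iff.mp hd]
  exact Ideal.smul_mem_pointwise_smul_iff

attribute [local instance] Ideal.Quotient.field in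
theorem exists_pow_smul_sub_mem {Q : Ideal (𝓞 M)} [Q.IsPrime] {p : ℕ} (hp : p.Prime)
    [Q.LiesOver (Ideal.span {(p : ℤ)})]
    {d : Gal(M/ℚ)} (hd : d ∈ MulAction.stabilizer Gal(M/ℚ) Q) :
    ∃ k : ℕ, ∀ x : 𝓞 M, d • x - x ^ p ^ k ∈ Q := by
  let 𝔭 : Ideal ℤ := Ideal.span {(p : ℤ)}
  have h𝔭 : 𝔭 ≠ ⊥ := by simp [𝔭, hp.ne_zero]
  have : 𝔭.IsPrime := (Ideal.span_singleton_prime (by simp [hp.ne_zero])).mpr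
    (Nat.prime_iff_prime_int.mp hp)
  have : 𝔭.IsMaximal := this.isMaximal h𝔭
  have hQ : Q ≠ ⊥ := Ideal.ne_bot_of_liesOver_of_ne_bot h𝔭 Q
  have : Q.IsMaximal := Ideal.IsPrime.isMaximal inferInstance hQ
  have : Finite (ℤ ⧸ 𝔭) := Nat.finite_of_card_ne_zero (by
    rw [Int.card_ideal_quot]; exact hp.ne_zero)
  have := Fintype.ofFinite (ℤ ⧸ 𝔭)
  have : Finite (𝓞 M ⧸ Q) := Ideal.finiteQuotientOfFreeOfNeBot Q hQ
  obtain ⟨k, hk⟩ := (FiniteField.bijective_frobeniusAlgEquivOfAlgebraic_pow (ℤ ⧸ 𝔭)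
    (𝓞 M ⧸ Q)).surjective (Ideal.Quotient.stabilizerHom Q 𝔭 Gal(M/ℚ) ⟨d, hd⟩)
  refine ⟨k, fun x ↦ ?_⟩
  rw [← Ideal.Quotient.eq]
  have h := DFunLike.congr_fun hk (Ideal.Quotient.mk Q x)
  rw [Ideal.Quotient.stabilizerHom_apply, AlgEquiv.coe_pow,
    FiniteField.coe_frobeniusAlgEquivOfAlgebraic_iterate, ← Nat.card_eq_fintype_card,
    Int.card_ideal_quot] at h
  rw [map_pow]
  exact h.symm

/-- On the residue field `d` acts as some power `φ ^ k`, so `φ * (φ ^ k)⁻¹ * d` is also a Frobenius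
at `Q`; uniqueness in the unramified case forces `d = φ ^ k`. -/
theorem mem_zpowers_of_mem_stabilizer [IsGalois ℚ M] {Q : Ideal (𝓞 M)} [Q.IsPrime] {p : ℕ}
    (hp : p.Prime) [Q.LiesOver (Ideal.span {(p : ℤ)})]
    (hunr : Algebra.IsUnramifiedIn (𝓞 M) (Ideal.span {(p : ℤ)})) {φ d : Gal(M/ℚ)}
    (hφ : IsArithFrobAt ℤ φ Q) (hd : d ∈ MulAction.stabilizer Gal(M/ℚ) Q) :
    d ∈ Subgroup.zpowers φ := by
  obtain ⟨k, hk⟩ := exists_pow_smul_sub_mem hp hd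
  have hφs := IsArithFrobAt.mem_stabilizer hφ
  have hφ' := isArithFrobAt_int_iff (p := p).mp hφ
  have hpow : ∀ x : 𝓞 M, φ ^ k • x - x ^ p ^ k ∈ Q := by
    clear hk
    induction k with
    | zero => intro x; simp
    | succ k ih =>
      intro x
      have h1 := (smul_mem_iff_of_mem_stabilizer hφs).mpr (ih x)
      rw [smul_sub, ← mul_smul, ← pow_succ'] at h1
      have h2 := hφ' (x ^ p ^ k)
      rw [← pow_mul, ← pow_succ] at h2
      simpa using add_mem h1 h2
  have hτ : IsArithFrobAt ℤ (φ * ((φ ^ k)⁻¹ * d)) Q := by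
    rw [isArithFrobAt_int_iff (p := p)]
    intro x
    have h1 : d • x - φ ^ k • x ∈ Q := by simpa using sub_mem (hk x) (hpow x)
    have h2 := (smul_mem_iff_of_mem_stabilizer (inv_mem (pow_mem hφs k))).mpr h1
    have h3 := (smul_mem_iff_of_mem_stabilizer hφs).mpr h2
    rw [smul_sub, inv_smul_smul, smul_sub, ← mul_smul, ← mul_smul] at h3
    simpa [mul_assoc] using add_mem h3 (hφ' x)
  have := IsArithFrobAt.eq_of_isUnramifiedIn hunr hτ hφ
  rw [mul_eq_left, inv_mul_eq_one] at this
  exact ⟨k, by simpa using this⟩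

variable [NumberField E]

variable (M E) in
theorem isGaloisGroup_ringOfIntegers (H : Subgroup Gal(M/ℚ)) [IsGaloisGroup H E M] :
    IsGaloisGroup H (𝓞 E) (𝓞 M) :=
  IsGaloisGroup.of_isFractionRing H (𝓞 E) (𝓞 M) E M

theorem under_smul_of_mem (H : Subgroup Gal(M/ℚ)) [IsGaloisGroup H E M] {h : Gal(M/ℚ)}
    (hh : h ∈ H) (Q : Ideal (𝓞 M)) : (h • Q).under (𝓞 E) = Q.under (𝓞 E) := by
  have := isGaloisGroup_ringOfIntegers M E H
  ext x
  have hx : h⁻¹ • algebraMap (𝓞 E) (𝓞 M) x = algebraMap (𝓞 E) (𝓞 M) x :=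
    smul_algebraMap (⟨h, hh⟩⁻¹ : H) x
  rw [Ideal.mem_comap, Ideal.mem_comap, Ideal.mem_pointwise_smul_iff_inv_smul_mem, hx]

/-- Since `ψ` fixes `E`, the residue field of `E` satisfies `x ^ p = x`. Its cyclic unit group then
has order dividing `p - 1`, while `p` divides its cardinality. -/
theorem absNorm_under_eq_of_frobenius_mem [IsGalois ℚ M] (H : Subgroup Gal(M/ℚ))
    [IsGaloisGroup H E M] {Q : Ideal (𝓞 M)} [Q.IsPrime] {p : ℕ} (hp : p.Prime)
    [Q.LiesOver (Ideal.span {(p : ℤ)})] {ψ : Gal(M/ℚ)} (hψ : IsArithFrobAt ℤ ψ Q) (hH : ψ ∈ H) :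
    Ideal.absNorm (Q.under (𝓞 E)) = p := by
  have := isGaloisGroup_ringOfIntegers M E H
  set P := Q.under (𝓞 E) with hPdef
  have hover : P.LiesOver (Ideal.span {(p : ℤ)}) := liesOver_under
  have hbot : P ≠ ⊥ := Ideal.ne_bot_of_liesOver_of_ne_bot (by simp [hp.ne_zero] :
    Ideal.span {(p : ℤ)} ≠ ⊥) P
  have hprime : P.IsPrime := inferInstance
  have hmax : P.IsMaximal := hprime.isMaximal hbot
  have hfin : Finite (𝓞 E ⧸ P) := Ideal.finiteQuotientOfFreeOfNeBot P hbot
  have := Fintype.ofFinite (𝓞 E ⧸ P)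
  let := Ideal.Quotient.field P
  have hfix : ∀ x : 𝓞 E ⧸ P, x ^ p = x := fun x ↦ by
    obtain ⟨x, rfl⟩ := Ideal.Quotient.mk_surjective x
    rw [← map_pow, eq_comm, Ideal.Quotient.eq, hPdef, Ideal.mem_comap]
    have hx : ψ • algebraMap (𝓞 E) (𝓞 M) x = algebraMap (𝓞 E) (𝓞 M) x :=
      smul_algebraMap (⟨ψ, hH⟩ : H) x
    have := isArithFrobAt_int_iff (p := p).mp hψ (algebraMap (𝓞 E) (𝓞 M) x)
    rwa [hx, ← map_pow, ← map_sub] at this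
  have hcard : Ideal.absNorm P = Fintype.card (𝓞 E ⧸ P) := by
    rw [Ideal.absNorm_apply, Submodule.cardQuot_apply, Nat.card_eq_fintype_card]
  have hdvd : Fintype.card (𝓞 E ⧸ P) - 1 ∣ p - 1 := by
    rw [← FiniteField.forall_pow_eq_one_iff]
    intro u
    have h1 : u ^ (p - 1) * u = 1 * u := by
      rw [← pow_succ, Nat.sub_add_cancel hp.one_lt.le, one_mul]
      exact Units.ext (by rw [Units.val_pow_eq_pow_val, hfix])
    exact mul_right_cancel h1
  have hp_dvd : p ∣ Ideal.absNorm P := by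
    have := Int.absNorm_under_dvd_absNorm P
    rwa [← hover.over, Ideal.absNorm_span_singleton, Algebra.norm_self, MonoidHom.id_apply,
      Int.natAbs_natCast] at this
  have h1 := Nat.le_of_dvd (Nat.sub_pos_of_lt hp.one_lt) hdvd
  have h2 := Nat.le_of_dvd (hcard ▸ Fintype.card_pos) hp_dvd
  have := hp.two_le
  omega

/-- The relative Frobenius of `M` over `E` lies in `H`. As the norm below is `p`, it is also a
Frobenius over `ℤ`, so it equals `ψ`. -/
theorem frobenius_mem_of_absNorm_under_eq [IsGalois ℚ M] (H : Subgroup Gal(M/ℚ))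
    [IsGaloisGroup H E M] {Q : Ideal (𝓞 M)} [Q.IsPrime] {p : ℕ} (hp : p.Prime)
    [Q.LiesOver (Ideal.span {(p : ℤ)})]
    (hunr : Algebra.IsUnramifiedIn (𝓞 M) (Ideal.span {(p : ℤ)})) {ψ : Gal(M/ℚ)}
    (hψ : IsArithFrobAt ℤ ψ Q) (hN : Ideal.absNorm (Q.under (𝓞 E)) = p) : ψ ∈ H := by
  have := isGaloisGroup_ringOfIntegers M E H
  have hQ : Q ≠ ⊥ := Ideal.ne_bot_of_liesOver_of_ne_bot (by simp [hp.ne_zero] :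
    Ideal.span {(p : ℤ)} ≠ ⊥) Q
  have : Finite (𝓞 M ⧸ Q) := Ideal.finiteQuotientOfFreeOfNeBot Q hQ
  obtain ⟨σ, hσ⟩ := IsArithFrobAt.exists_of_isInvariant (𝓞 E) H Q
  have hσ' : IsArithFrobAt ℤ (σ : Gal(M/ℚ)) Q := by
    rw [isArithFrobAt_int_iff (p := p)]
    intro x
    have h := hσ x
    rwa [← Submodule.cardQuot_apply, ← Ideal.absNorm_apply, hN] at h
  rw [IsArithFrobAt.eq_of_isUnramifiedIn hunr hψ hσ']
  exact σ.2

/-- The coset `gH` corresponds to the prime of `E` below `g⁻¹ • Q`. The Frobenius there is `g⁻¹ * φ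
* g`, which lies in `H` exactly when `φ` fixes `gH` and exactly when the prime below has norm `p`.
-/
theorem zetaCoeff_eq_permChar [IsGalois ℚ M] (H : Subgroup Gal(M/ℚ))
    [IsGaloisGroup H E M] {Q : Ideal (𝓞 M)} [Q.IsPrime] {p : ℕ} (hp : p.Prime)
    [Q.LiesOver (Ideal.span {(p : ℤ)})]
    (hunr : Algebra.IsUnramifiedIn (𝓞 M) (Ideal.span {(p : ℤ)})) {φ : Gal(M/ℚ)}
    (hφ : IsArithFrobAt ℤ φ Q) : (zetaCoeff E p : ℝ) = permChar H φ := by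
  have := isGaloisGroup_ringOfIntegers M E H
  have hfrob : ∀ g : Gal(M/ℚ), IsArithFrobAt ℤ (g⁻¹ * φ * g) (g⁻¹ • Q) := fun g ↦ by
    simpa using IsArithFrobAt.conj hφ g⁻¹
  rw [permChar, zetaCoeff, Nat.cast_inj, eq_comm]
  have hout : ∀ a : Gal(M/ℚ) ⧸ H, ((a.out : Gal(M/ℚ)) : Gal(M/ℚ) ⧸ H) = a := fun a ↦
    QuotientGroup.out_eq' a
  have hunder : ∀ g : Gal(M/ℚ), (((g : Gal(M/ℚ) ⧸ H).out)⁻¹ • Q).under (𝓞 E) =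
      (g⁻¹ • Q).under (𝓞 E) := fun g ↦ by
    obtain ⟨h, hh⟩ := QuotientGroup.mk_out_eq_mul H g
    rw [hh, mul_inv_rev, mul_smul]
    exact under_smul_of_mem H (inv_mem h.2) _
  refine Nat.card_eq_of_bijective (fun a : MulAction.fixedBy (Gal(M/ℚ) ⧸ H) φ ↦
    (⟨(a.1.out⁻¹ • Q).under (𝓞 E), absNorm_under_eq_of_frobenius_mem H hp (hfrob _)
      (mk_mem_fixedBy_iff.mp (by rw [hout]; exact a.2))⟩ :
      {I : Ideal (𝓞 E) // Ideal.absNorm I = p})) ⟨?_, ?_⟩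
  · rintro ⟨a, ha⟩ ⟨b, hb⟩ hab
    obtain ⟨g, rfl⟩ := QuotientGroup.mk_surjective a
    obtain ⟨g', rfl⟩ := QuotientGroup.mk_surjective b
    have h1 := congrArg Subtype.val hab
    simp only [hunder] at h1
    obtain ⟨h, hh⟩ := Algebra.IsInvariant.exists_smul_of_under_eq (𝓞 E) (𝓞 M) H _ _ h1
    -- Primes with the same restriction to `E` are `H`-conjugate. The resulting element stabilizes
    -- `Q`, so it is a power of `φ`, fixes `gH`, and also carries it to `g'H`.
    have hd : g' * h * g⁻¹ ∈ MulAction.stabilizer Gal(M/ℚ) Q := by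
      have hh' : g'⁻¹ • Q = (h : Gal(M/ℚ)) • g⁻¹ • Q := hh
      rw [MulAction.mem_stabilizer_iff, mul_smul, mul_smul, ← hh', smul_inv_smul]
    have h2 := mem_zpowers_of_mem_stabilizer hp hunr hφ hd
    have h3 := fixedBy_subset_of_mem_zpowers h2 ha
    rw [MulAction.mem_fixedBy, MulAction.Quotient.smul_coe, smul_eq_mul, inv_mul_cancel_right] at h3
    exact Subtype.ext (h3.symm.trans (QuotientGroup.mk_mul_of_mem _ h.2))
  · rintro ⟨P, hP⟩
    have hprime : P.IsPrime := Ideal.isPrime_of_irreducible_absNorm (hP ▸ hp)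
    have hbot : P ≠ ⊥ := fun h ↦ hp.ne_zero (by rw [← hP, h, Ideal.absNorm_bot])
    have hmax : P.IsMaximal := hprime.isMaximal hbot
    have hPp : P.LiesOver (Ideal.span {(p : ℤ)}) :=
      (Ideal.liesOver_span_iff hprime.ne_top (Nat.prime_iff_prime_int.mp hp)).mpr
        (by simpa using natCast_mem_of_absNorm_dvd hP.dvd)
    obtain ⟨Q', hQ'max, hQ'⟩ := Ideal.exists_maximal_ideal_liesOver_of_isIntegral (S := 𝓞 M) P
    have hQ'p : Q'.LiesOver (Ideal.span {(p : ℤ)}) := Ideal.LiesOver.trans Q' P _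
    obtain ⟨σ, hσ⟩ := Ideal.exists_smul_eq_of_isGaloisGroup (Ideal.span {(p : ℤ)}) Q Q' Gal(M/ℚ)
    have hunder' : (σ⁻¹⁻¹ • Q).under (𝓞 E) = P := by rw [inv_inv, hσ, ← hQ'.over]
    refine ⟨⟨((σ⁻¹ : Gal(M/ℚ)) : Gal(M/ℚ) ⧸ H), mk_mem_fixedBy_iff.mpr ?_⟩, ?_⟩
    · exact frobenius_mem_of_absNorm_under_eq (E := E) H hp hunr (hfrob _) (by rw [hunder', hP])
    · exact Subtype.ext ((hunder _).trans hunder')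

end Frobenius

end

end ArithEquiv

namespace ArithEquiv

noncomputable section

open NumberField

/-! ### Pointwise comparison on the Galois group. -/

section Agreement

variable {G : Type*} [Group G]

open Classical in
/-- The indicator function of the agreement of two permutation characters. -/
def agree (H₁ H₂ : Subgroup G) (g : G) : ℝ := if permChar H₁ g = permChar H₂ g then 1 else 0

theorem agree_constOnDivisions (H₁ H₂ : Subgroup G) : ConstOnDivisions (agree H₁ H₂) := by
  intro g g' x h
  simp only [agree, permChar_constOnDivisions H₁ g g' x h, permChar_constOnDivisions H₂ g g' x h]

/-- The function `1 - 1_{N₁} - 1_{N₂} + 2 · 1_{1}` on the Galois group. -/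
def comparison (N₁ N₂ : Subgroup G) : G → ℝ :=
  permChar ⊤ + (-(1 / N₁.index : ℝ)) • permChar N₁ + (-(1 / N₂.index : ℝ)) • permChar N₂ +
    (2 / (⊥ : Subgroup G).index : ℝ) • permChar ⊥

variable [Finite G]

open Classical in
theorem comparison_apply (N₁ N₂ : Subgroup G) [N₁.Normal] [N₂.Normal] (g : G) :
    comparison N₁ N₂ g = 1 - (if g ∈ N₁ then 1 else 0) - (if g ∈ N₂ then 1 else 0) +
      2 * (if g = 1 then 1 else 0) := by
  have key : ∀ N : Subgroup G, (N.index : ℝ) ≠ 0 := fun N ↦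
    Nat.cast_ne_zero.mpr Subgroup.index_ne_zero_of_finite
  simp only [comparison, Pi.add_apply, Pi.smul_apply, permChar_of_normal, smul_eq_mul,
    Subgroup.mem_top, Subgroup.mem_bot, if_true, Subgroup.index_top, mul_ite, mul_zero, neg_mul,
    one_div, inv_mul_cancel₀ (key _), div_mul_cancel₀ _ (key _)]
  split_ifs <;> norm_num

variable {H₁ H₂ : Subgroup G}

/-- The right side is 0 when `g` lies in exactly one core and 1 otherwise, and agreement with equal
indices excludes the former case. -/
theorem agree_le_comparison (hi : H₁.index = H₂.index) (h : H₁.normalCore ⊓ H₂.normalCore = ⊥)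
    (g : G) : agree H₁ H₂ g ≤ comparison H₁.normalCore H₂.normalCore g := by
  rw [comparison_apply, agree]
  have h1 : g ∈ H₁.normalCore → g ∈ H₂.normalCore → g = 1 := fun h₁ h₂ ↦ by
    rw [← Subgroup.mem_bot, ← h]
    exact ⟨h₁, h₂⟩
  have h2 : permChar H₁ g = permChar H₂ g → (g ∈ H₁.normalCore ↔ g ∈ H₂.normalCore) := fun he ↦ by
    rw [← permChar_eq_index_iff, ← permChar_eq_index_iff, he, hi]
  have h3 : g = 1 → g ∈ H₁.normalCore ∧ g ∈ H₂.normalCore := fun h ↦ h ▸ ⟨one_mem _, one_mem _⟩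
  split_ifs <;> first | norm_num; done | (exfalso; tauto)

theorem agree_eq_comparison [H₁.Normal] [H₂.Normal] (hi : H₁.index = H₂.index)
    (h : H₁ ⊓ H₂ = ⊥) (g : G) : agree H₁ H₂ g = comparison H₁ H₂ g := by
  classical
  rw [comparison_apply, agree,
    permChar_of_normal, permChar_of_normal, hi]
  have h1 : g ∈ H₁ → g ∈ H₂ → g = 1 := fun h₁ h₂ ↦ by
    rw [← Subgroup.mem_bot, ← h]
    exact ⟨h₁, h₂⟩
  have h3 : g = 1 → g ∈ H₁ ∧ g ∈ H₂ := fun h ↦ h ▸ ⟨one_mem _, one_mem _⟩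
  have h4 : (H₂.index : ℝ) ≠ 0 := Nat.cast_ne_zero.mpr Subgroup.index_ne_zero_of_finite
  have h5 := h4.symm
  split_ifs <;> first | norm_num; done | (exfalso; tauto)

end Agreement

/-! ### The Frobenius density theorem. -/

section FrobeniusDensity

theorem finite_not_unramified (E : Type*) [Field E] [NumberField E] :
    {p | ¬ Unramified E p}.Finite := by
  have hinj : Function.Injective fun p : Nat.Primes ↦ (p : ℕ) := Subtype.val_injective
  refine Set.Finite.of_finite_image (f := fun p : Nat.Primes ↦ (p : ℕ)) ?_ hinj.injOn
  refine (discr E).natAbs.divisors.finite_toSet.subset ?_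
  rintro _ ⟨p, hp, rfl⟩
  have h : ((p : ℕ) : ℤ) ∣ discr E := by
    by_contra hn
    exact hp ((not_dvd_discr_iff_isUnramifiedIn E (𝓞 E)
      (Nat.prime_iff_prime_int.mp p.2)).mp hn)
  rw [Finset.mem_coe, Nat.mem_divisors]
  exact ⟨Int.natCast_dvd.mp h, Int.natAbs_ne_zero.mpr (discr_ne_zero E)⟩

variable (M : Type*) [Field M] [NumberField M] [IsGalois ℚ M]

theorem exists_isArithFrobAt (p : Nat.Primes) : ∃ (φ : Gal(M/ℚ)) (Q : Ideal (𝓞 M)),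
    Q.IsPrime ∧ Q.LiesOver (Ideal.span {((p : ℕ) : ℤ)}) ∧ IsArithFrobAt ℤ φ Q := by
  have hbot : Ideal.span {((p : ℕ) : ℤ)} ≠ ⊥ := by simp [p.2.ne_zero]
  have hprime : (Ideal.span {((p : ℕ) : ℤ)}).IsPrime :=
    (Ideal.span_singleton_prime (by simp [p.2.ne_zero])).mpr (Nat.prime_iff_prime_int.mp p.2)
  have hmax : (Ideal.span {((p : ℕ) : ℤ)}).IsMaximal := hprime.isMaximal hbot
  obtain ⟨Q, hQmax, hQ⟩ := Ideal.exists_maximal_ideal_liesOver_of_isIntegral (S := 𝓞 M)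
    (Ideal.span {((p : ℕ) : ℤ)})
  have : Finite (𝓞 M ⧸ Q) :=
    Ideal.finiteQuotientOfFreeOfNeBot Q (Ideal.ne_bot_of_liesOver_of_ne_bot hbot Q)
  obtain ⟨φ, hφ⟩ := IsArithFrobAt.exists_of_isInvariant ℤ Gal(M/ℚ) Q
  exact ⟨φ, Q, hQmax.isPrime, hQ, hφ⟩

/-- A choice of a Frobenius element at some prime of `M` above `p`. -/
def frob (p : Nat.Primes) : Gal(M/ℚ) := (exists_isArithFrobAt M p).choose

variable {M}

theorem zetaCoeff_eq_permChar_frob {E : Type*} [Field E] [NumberField E] [Algebra E M]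
    (H : Subgroup Gal(M/ℚ)) [IsGaloisGroup H E M] {p : Nat.Primes} (hp : Unramified M p) :
    (zetaCoeff E p : ℝ) = permChar H (frob M p) := by
  obtain ⟨Q, hQprime, hQ, hφ⟩ := (exists_isArithFrobAt M p).choose_spec
  exact zetaCoeff_eq_permChar H p.2 hp hφ

theorem hasMean_permChar (H : Subgroup Gal(M/ℚ)) :
    HasMean (fun p ↦ permChar H (frob M p)) 1 := by
  let E : IntermediateField ℚ M := FixedPoints.intermediateField H
  refine (hasMean_zetaCoeff E).congr_finite (isBdd_zetaCoeff E)
    ((finite_not_unramified M).subset fun p hp hunr ↦ hp ?_)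
  exact zetaCoeff_eq_permChar_frob H hunr

variable (M) in
/-- The functions on the Galois group whose values at Frobenius elements have a mean value. -/
def meanSubmodule : Submodule ℝ (Gal(M/ℚ) → ℝ) where
  carrier := {F | ∃ ℓ, HasMean (fun p ↦ F (frob M p)) ℓ}
  add_mem' := fun ⟨_, h⟩ ⟨_, h'⟩ ↦ ⟨_, h.add h' (isBdd_comp _ _) (isBdd_comp _ _)⟩
  zero_mem' := ⟨0, hasMean_zero_of_finite_support (by simp)⟩
  smul_mem' := fun a _ ⟨_, h⟩ ↦ ⟨_, h.smul a⟩

/-- The **Frobenius density theorem**, without the value of the density. -/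
theorem ConstOnDivisions.exists_hasMean {F : Gal(M/ℚ) → ℝ} (hF : ConstOnDivisions F) :
    ∃ ℓ, HasMean (fun p ↦ F (frob M p)) ℓ :=
  hF.mem_of_permChar_mem (V := meanSubmodule M) fun H ↦ ⟨1, hasMean_permChar H⟩

end FrobeniusDensity

/-! ### Mean value of the comparison function, and its relation to `T K L`. -/

section Comparison

variable {M : Type*} [Field M] [NumberField M] [IsGalois ℚ M]

theorem index_eq_finrank {E : Type*} [Field E] [NumberField E] [Algebra E M]
    (H : Subgroup Gal(M/ℚ)) [IsGaloisGroup H E M] : H.index = Module.finrank ℚ E := by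
  have h1 : Nat.card H = Module.finrank E M := IsGaloisGroup.card_eq_finrank H E M
  have h2 : Nat.card Gal(M/ℚ) = Module.finrank ℚ M := IsGaloisGroup.card_eq_finrank _ ℚ M
  have h3 := H.card_mul_index
  rw [h2, ← Module.finrank_mul_finrank ℚ E M, h1, mul_comm] at h3
  exact Nat.eq_of_mul_eq_mul_right (h1 ▸ Nat.card_pos) h3

/-- Every permutation character has mean value 1, so the mean value is the sum of the coefficients.
-/
theorem hasMean_comparison (N₁ N₂ : Subgroup Gal(M/ℚ)) :
    HasMean (fun p ↦ comparison N₁ N₂ (frob M p))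
      (2 / Module.finrank ℚ M + 1 - 1 / N₁.index - 1 / N₂.index) := by
  have hb := fun F : Gal(M/ℚ) → ℝ ↦ isBdd_comp F (frob M)
  have h := (((hasMean_permChar (⊤ : Subgroup Gal(M/ℚ))).add
    ((hasMean_permChar N₁).smul (-(1 / N₁.index : ℝ))) (hb _)
      (hb ((-(1 / N₁.index : ℝ)) • permChar N₁))).add
    ((hasMean_permChar N₂).smul (-(1 / N₂.index : ℝ)))
      (hb (permChar ⊤ + (-(1 / N₁.index : ℝ)) • permChar N₁))
      (hb ((-(1 / N₂.index : ℝ)) • permChar N₂))).add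
    ((hasMean_permChar ⊥).smul (2 / (⊥ : Subgroup Gal(M/ℚ)).index : ℝ))
      (hb (permChar ⊤ + (-(1 / N₁.index : ℝ)) • permChar N₁ +
        (-(1 / N₂.index : ℝ)) • permChar N₂))
      (hb ((2 / (⊥ : Subgroup Gal(M/ℚ)).index : ℝ) • permChar ⊥))
  have hbot : (⊥ : Subgroup Gal(M/ℚ)).index = Module.finrank ℚ M := by
    rw [Subgroup.index_bot]
    exact IsGaloisGroup.card_eq_finrank _ ℚ M
  convert! h using 1
  rw [hbot]
  ring

variable {K L : Type*} [Field K] [NumberField K] [Field L] [NumberField L] [Algebra K M]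
  [Algebra L M]

theorem hasMean_indicator_T {d : ℝ} (H₁ H₂ : Subgroup Gal(M/ℚ)) [IsGaloisGroup H₁ K M]
    [IsGaloisGroup H₂ L M] (h : HasMean (fun p ↦ agree H₁ H₂ (frob M p)) d) :
    HasMean ((T K L).indicator 1) d := by
  refine h.congr_finite (isBdd_comp _ _) ((((finite_not_unramified M).union
    (finite_not_unramified K)).union (finite_not_unramified L)).subset fun p hp ↦ ?_)
  by_contra hn
  simp only [Set.mem_union, Set.mem_ofPred_eq, not_or, not_not] at hn
  obtain ⟨⟨hM, hK⟩, hL⟩ := hn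
  refine hp ?_
  have hT : p ∈ T K L ↔ permChar H₁ (frob M p) = permChar H₂ (frob M p) := by
    rw [← zetaCoeff_eq_permChar_frob (E := K) H₁ hM, ← zetaCoeff_eq_permChar_frob (E := L) H₂ hM,
      Nat.cast_inj]
    refine ⟨fun h ↦ h.1, fun h ↦ ⟨h, ?_⟩⟩
    rintro (h | h)
    · exact h hK
    · exact h hL
  by_cases hp : p ∈ T K L
  · rw [Set.indicator_of_mem hp, agree, if_pos (hT.mp hp), Pi.one_apply]
  · rw [Set.indicator_of_notMem hp, agree, if_neg (mt hT.mpr hp)]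

end Comparison

end

end ArithEquiv

namespace ArithEquiv

noncomputable section

open NumberField

/-! ### Normal cores and Galois closures. -/

section NormalClosure

variable {M : Type*} [Field M] [NumberField M] [IsGalois ℚ M]
  {K : Type*} [Field K] [Algebra K M]

theorem mem_iff_forall_algebraMap (H : Subgroup Gal(M/ℚ)) [IsGaloisGroup H K M] (g : Gal(M/ℚ)) :
    g ∈ H ↔ ∀ k : K, g (algebraMap K M k) = algebraMap K M k := by
  rw [← IsGaloisGroup.fixingSubgroup_range_algebraMap' Gal(M/ℚ) ℚ M H K, mem_fixingSubgroup_iff]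
  simp

variable [NumberField K]

/-- Every embedding of `K` into the normal field `M` is the given one followed by an automorphism of
`M`, so conjugating `H` runs through all embeddings. -/
theorem mem_normalCore_iff_forall_algHom (H : Subgroup Gal(M/ℚ)) [IsGaloisGroup H K M]
    (g : Gal(M/ℚ)) : g ∈ H.normalCore ↔ ∀ (f : K →ₐ[ℚ] M) (k : K), g (f k) = f k := by
  have hconj : ∀ x : Gal(M/ℚ), x * g * x⁻¹ ∈ H ↔
      ∀ k : K, g (x⁻¹ (algebraMap K M k)) = x⁻¹ (algebraMap K M k) := fun x ↦ by
    rw [mem_iff_forall_algebraMap (K := K)]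
    refine forall_congr' fun k ↦ ?_
    rw [AlgEquiv.mul_apply, AlgEquiv.mul_apply, AlgEquiv.aut_inv, AlgEquiv.eq_symm_apply]
  constructor
  · intro hg f k
    let ι : K →ₐ[ℚ] M := IsScalarTower.toAlgHom ℚ K M
    let χ : ι.fieldRange ≃ₐ[ℚ] f.fieldRange := ι.equivFieldRange.symm.trans f.equivFieldRange
    have hx : χ.liftNormal M (algebraMap K M k) = f k := by
      have h := χ.liftNormal_commutes M (ι.equivFieldRange k)
      have h' : χ (ι.equivFieldRange k) = f.equivFieldRange k :=
        congrArg f.equivFieldRange (ι.equivFieldRange.symm_apply_apply k)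
      rw [h'] at h
      exact h
    have := (hconj (χ.liftNormal M)⁻¹).mp (hg _) k
    rwa [inv_inv, hx] at this
  · intro h x
    rw [hconj]
    exact h ((x⁻¹ : Gal(M/ℚ)).toAlgHom.comp (IsScalarTower.toAlgHom ℚ K M))

theorem normalCore_eq_fixingSubgroup (H : Subgroup Gal(M/ℚ)) [IsGaloisGroup H K M] :
    H.normalCore = (IntermediateField.normalClosure ℚ K M).fixingSubgroup := by
  ext g
  rw [mem_normalCore_iff_forall_algHom (K := K), ← Subgroup.zpowers_le,
    ← IntermediateField.le_iff_le]
  refine Iff.trans ?_ iSup_le_iff.symm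
  refine forall_congr' fun f ↦ ?_
  constructor
  · rintro h _ ⟨k, rfl⟩
    rw [IntermediateField.mem_fixedField_iff]
    intro σ hσ
    have : Subgroup.zpowers g ≤ MulAction.stabilizer Gal(M/ℚ) (f k) := by
      rw [Subgroup.zpowers_le]
      exact h k
    exact this hσ
  · intro h k
    have := h ⟨k, rfl⟩
    rw [IntermediateField.mem_fixedField_iff] at this
    exact this g (Subgroup.mem_zpowers g)

/-- The index is the degree of the normal closure taken inside `M`; normal closures are isomorphic,
so the one in `AlgebraicClosure ℚ` has the same degree. -/
theorem index_normalCore (H : Subgroup Gal(M/ℚ)) [IsGaloisGroup H K M] :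
    H.normalCore.index = Module.finrank ℚ (galoisClosure K) := by
  have h1 : IsGaloisGroup H.normalCore (IntermediateField.normalClosure ℚ K M) M := by
    rw [normalCore_eq_fixingSubgroup (K := K)]
    exact IsGaloisGroup.intermediateField Gal(M/ℚ) ℚ M _
  rw [index_eq_finrank (E := IntermediateField.normalClosure ℚ K M)]
  have hs : ∀ x : K, ((minpoly ℚ x).map (algebraMap ℚ M)).Splits := fun x ↦ by
    have := Normal.splits (F := ℚ) (K := M) inferInstance (algebraMap K M x)
    rwa [minpoly.algebraMap_eq (algebraMap K M).injective] at this
  have hM : IsNormalClosure ℚ K (IntermediateField.normalClosure ℚ K M) :=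
    Algebra.IsAlgebraic.isNormalClosure_normalClosure hs
  have hΩ : IsNormalClosure ℚ K (galoisClosure K) :=
    Algebra.IsAlgebraic.isNormalClosure_normalClosure fun x ↦ IsAlgClosed.splits _
  exact (IsNormalClosure.equiv (F := ℚ) (K := K)).toLinearEquiv.finrank_eq

end NormalClosure

/-! ### The compositum of the two Galois closures. -/

section Compositum

variable (K L : Type*) [Field K] [NumberField K] [Field L] [NumberField L]

/-- The compositum of the Galois closures of `K` and `L`. -/
abbrev galoisCompositum : IntermediateField ℚ (AlgebraicClosure ℚ) :=
  galoisClosure K ⊔ galoisClosure L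

instance : NumberField (galoisCompositum K L) where
  to_charZero := inferInstance
  to_finiteDimensional := IntermediateField.finiteDimensional_sup _ _

instance : IsGalois ℚ (galoisCompositum K L) where
  to_isSeparable := inferInstance
  to_normal := by
    have : IsAlgClosure ℚ (AlgebraicClosure ℚ) := by
      convert! (inferInstance : @IsAlgClosure ℚ (AlgebraicClosure ℚ) _ _
        (AlgebraicClosure.instAlgebra ℚ) _)
    have : Normal ℚ (AlgebraicClosure ℚ) := IsAlgClosure.normal ℚ _
    have := normalClosure.normal ℚ K (AlgebraicClosure ℚ)
    have := normalClosure.normal ℚ L (AlgebraicClosure ℚ)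
    exact IntermediateField.normal_sup _ _ _ _

variable {K L}

theorem mem_fixed_of_forall_algHom {M : IntermediateField ℚ (AlgebraicClosure ℚ)}
    (hM : galoisClosure K ≤ M) {g : Gal(M/ℚ)}
    (h : ∀ (f : K →ₐ[ℚ] M) (k : K), g (f k) = f k) :
    galoisClosure K ≤ IntermediateField.lift (IntermediateField.fixedField (Subgroup.zpowers g)) := by
  refine iSup_le ?_
  rintro f _ ⟨k, rfl⟩
  let f' : K →ₐ[ℚ] M := f.codRestrict M.toSubalgebra fun k ↦
    hM (f.fieldRange_le_normalClosure ⟨k, rfl⟩)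
  change ((f' k : M) : AlgebraicClosure ℚ) ∈ _
  rw [IntermediateField.mem_lift, IntermediateField.mem_fixedField_iff]
  have : Subgroup.zpowers g ≤ MulAction.stabilizer Gal(M/ℚ) (f' k) := by
    rw [Subgroup.zpowers_le]
    exact h f' k
  exact fun σ hσ ↦ this hσ

/-- An element of both cores fixes both Galois closures, hence the field they generate, which is all
of `M`. -/
theorem normalCore_inf_normalCore_eq_bot [Algebra K (galoisCompositum K L)]
    [Algebra L (galoisCompositum K L)] (H₁ H₂ : Subgroup Gal(galoisCompositum K L/ℚ))
    [IsGaloisGroup H₁ K (galoisCompositum K L)] [IsGaloisGroup H₂ L (galoisCompositum K L)] :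
    H₁.normalCore ⊓ H₂.normalCore = ⊥ := by
  rw [eq_bot_iff]
  intro g hg
  obtain ⟨h₁, h₂⟩ := Subgroup.mem_inf.mp hg
  rw [mem_normalCore_iff_forall_algHom (K := K)] at h₁
  rw [mem_normalCore_iff_forall_algHom (K := L)] at h₂
  have h := sup_le (mem_fixed_of_forall_algHom le_sup_left h₁)
    (mem_fixed_of_forall_algHom le_sup_right h₂)
  rw [Subgroup.mem_bot]
  ext x
  have hx := h x.2
  rw [IntermediateField.mem_lift, IntermediateField.mem_fixedField_iff] at hx
  exact congrArg Subtype.val (hx g (Subgroup.mem_zpowers g))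

/-- An embedding of `E` into an intermediate field containing its Galois closure. -/
def toGaloisClosure (E : Type*) [Field E] [NumberField E]
    {M : IntermediateField ℚ (AlgebraicClosure ℚ)} (hM : galoisClosure E ≤ M) : E →ₐ[ℚ] M :=
  (IsAlgClosed.lift : E →ₐ[ℚ] AlgebraicClosure ℚ).codRestrict M.toSubalgebra fun k ↦
    hM (AlgHom.fieldRange_le_normalClosure _ ⟨k, rfl⟩)

end Compositum

end

end ArithEquiv

/-! ### The theorem. -/

open ArithEquiv in
theorem proposition2p8 (n : ℕ) (K L : Type*) [Field K] [NumberField K] [Field L] [NumberField L]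
    (hK : Module.finrank ℚ K = n) (hL : Module.finrank ℚ L = n) :
    ∃ d : ℝ, ArithEquiv.HasDensity (ArithEquiv.T K L) d ∧
      d ≤ ArithEquiv.delta K L ∧
      (IsGalois ℚ K → IsGalois ℚ L → d = ArithEquiv.delta K L) := by
  let M := galoisCompositum K L
  let : Algebra K M := (toGaloisClosure K (M := M) le_sup_left).toRingHom.toAlgebra
  let : Algebra L M := (toGaloisClosure L (M := M) le_sup_right).toRingHom.toAlgebra
  let H₁ : Subgroup Gal(M/ℚ) := fixingSubgroup Gal(M/ℚ) (Set.range (algebraMap K M))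
  let H₂ : Subgroup Gal(M/ℚ) := fixingSubgroup Gal(M/ℚ) (Set.range (algebraMap L M))
  have : IsGaloisGroup H₁ K M := IsGaloisGroup.of_isScalarTower Gal(M/ℚ) ℚ M K
  have : IsGaloisGroup H₂ L M := IsGaloisGroup.of_isScalarTower Gal(M/ℚ) ℚ M L
  have hindex : H₁.index = H₂.index := by
    rw [index_eq_finrank (E := K) H₁, index_eq_finrank (E := L) H₂, hK, hL]
  have hbot : H₁.normalCore ⊓ H₂.normalCore = ⊥ := normalCore_inf_normalCore_eq_bot H₁ H₂
  obtain ⟨d, hd⟩ := (agree_constOnDivisions H₁ H₂).exists_hasMean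
  have hcomp := hasMean_comparison H₁.normalCore H₂.normalCore
  rw [index_normalCore (K := K), index_normalCore (K := L)] at hcomp
  refine ⟨d, (hasDensity_iff_hasMean_indicator _ _).mpr (hasMean_indicator_T H₁ H₂ hd),
    hd.mono hcomp (isBdd_comp _ _) (isBdd_comp _ _) fun p ↦
      agree_le_comparison hindex hbot _, fun hKgal hLgal ↦ ?_⟩
  have h₁ : H₁.Normal := IsGaloisGroup.normal_of_isGalois Gal(M/ℚ) ℚ M H₁ K
  have h₂ : H₂.Normal := IsGaloisGroup.normal_of_isGalois Gal(M/ℚ) ℚ M H₂ L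
  -- Normal subgroups are their own cores, so agreement and comparison coincide pointwise and have
  -- the same mean value.
  rw [Subgroup.normalCore_eq_self, Subgroup.normalCore_eq_self] at hcomp hbot
  simp only [← agree_eq_comparison hindex hbot] at hcomp
  exact hd.unique hcomp
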